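/- Let $\Sigma$ be an integer alphabet of size $\sigma$, let $\$$ be a delimiter smaller than all characters of $\Sigma$, and let $T\in\Sigma^*$ have Lyndon factorization $T=T_1\cdots T_t$ (non-increasing Lyndon words). For a word $S$, $\mathrm{BBWT}_S$ is the word formed by the last characters of all conjugates of all Lyndon factors of $S$ (with multiplicity), where the conjugates are sorted by $\prec_\omega$ ($u\prec_\omega v$ iff $uuu\cdots$ is lexicographically smaller than $vvv\cdots$); $\mathrm{BWT}_S:=\mathrm{BBWT}_{\$S}$, of length $|S|+1$. For a word $L$ with sorted sequence of characters $\mathrm{First}$, let $\mathrm{FL}[i]=L.\mathrm{select}_{\mathrm{First}[i]}(\mathrm{First}.\mathrm{rank}_{\mathrm{First}[i]}(i))$. Inversion algorithm on a word $L$: while $L$ is not empty, insert $\$$ at position $2$ of $L$ and let $p=2$; while $p\neq 1$, let $p'=\mathrm{FL}[p]$, output $L[p']$, set $L[p']\gets\$$, delete the entry $L[p]$, and let $p$ be the new position of $\$$; finally delete $L[1]=\$$. 1. Started with $L=\mathrm{BBWT}_T$, the algorithm terminates, and its rounds output exactly the Lyndon factors $T_t,T_{t-1},\dots,T_1$, in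 this order. More precisely, for $1\le x\le t$, in the round that starts with $\mathrm{BBWT}_{T_1\cdots T_x}$, after $i\le |T_x|$ inner steps the output is $T_x[1..i]$, the current word is $\mathrm{BBWT}_{T_1\cdots T_{x-1}\,\$\,T_x[i+1..]}$ with $\$$ at position $p$, and $p=1$ iff $i=|T_x|$; deleting the first entry then leaves $\mathrm{BBWT}_{T_1\cdots T_{x-1}}$. 2. $\mathrm{BBWT}$ can be inverted in-place in $O(n^2)$ time on the word RAM: there is a word RAM program such that for every $k$ there is a constant $C$ such that for all $n\ge1$, all $\sigma\le k\,n^k$ (that is, $\sigma=n^{O(1)}$), all word sizes $w$ with $2^w\ge n+\sigma+2$ and all $T\in\Sigma^n$, the program, started with $\mathrm{BBWT}_T$ in $n$ memory cells, halts after at most $C n^2$ unit-cost steps with $T$ in these cells. At all times each cell holds a symbol of $\Sigma\cup\{\$\}$, at most one cell holds $\$$, and besides the cells at most $C\cdot(\lfloor\lg n\rfloor+1)$ bits of working space (in registers) are in use. During the computation the memory holds $\mathrm{BBWT}_{T_1\cdots T_x}\,T_{x+1}\cdots T_t$ for $x=t,t-1,\dots,0$ at increasing times. 3. $\mathrm{BBWT}$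 can be converted to $\mathrm{BWT}$ in-place in $O(n^2)$ time: with the same quantification and the same restrictions on time and space, there is a word RAM program that, started with $\mathrm{BBWT}_T\,\$$ in $n+1$ memory cells, halts with $\mathrm{BWT}_T$ in these cells; during the computation the memory holds $\mathrm{BBWT}_{T_1\cdots T_x}\,\mathrm{BWT}_{T_{x+1}\cdots T_t}$ for $x=t,t-1,\dots,0$ at increasing times. -/

import Mathlib

namespace BBWT

/-- A Lyndon word: a non-empty word that is lexicographically strictly smaller than each of its
other conjugates (rotations). -/
def IsLyndon {α : Type*} [LinearOrder α] (w : List α) : Prop :=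
  w ≠ [] ∧ ∀ i, 0 < i → i < w.length → w < w.rotate i

/-- `fs` is a Lyndon factorization of `T`: a factorization of `T` into Lyndon words that are
lexicographically non-increasing. -/
def IsLyndonFactorization {α : Type*} [LinearOrder α] (fs : List (List α)) (T : List α) : Prop :=
  fs.flatten = T ∧ (∀ f ∈ fs, IsLyndon f) ∧ fs.Pairwise (fun u v => v ≤ u)

theorem exists_suffix_prefix {α : Type*} (fs : List (List α)) (r : List α) (hr : r ≠ [])
    (hp : r <+: fs.flatten) : ∃ q s f, r = q ++ s ∧ s ≠ [] ∧ f ∈ fs ∧ s <+: f := by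
  induction fs generalizing r with
  | nil => simp at hp; exact absurd hp hr
  | cons f fs ih =>
    rw [List.flatten_cons] at hp
    by_cases hl : r.length ≤ f.length
    · have hp := List.prefix_of_prefix_length_le hp (List.prefix_append f _) hl
      exact ⟨[], r, f, by simp, hr, by simp, hp⟩
    · obtain ⟨t, rfl⟩ := List.prefix_of_prefix_length_le (List.prefix_append f _) hp (not_le.1 hl).le
      have ht : t <+: fs.flatten := (List.prefix_append_right_inj f).1 hp
      by_cases h0 : t = []
      · exact absurd (by simp [h0]) hl
      · obtain ⟨q, s, g, rfl, hs, hg, hsg⟩ := ih t h0 ht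
        exact ⟨f ++ q, s, g, by simp, hs, by simp [hg], hsg⟩

section lyndonFacts

variable {α : Type*} [LinearOrder α]

theorem append_lt_append_of_not_prefix {a b : List α} (h : a < b) (hp : ¬ a <+: b)
    (s t : List α) : a ++ s < b ++ t := by
  induction a generalizing b with
  | nil => exact absurd (List.nil_prefix) hp
  | cons x a ih =>
    cases b with
    | nil => exact absurd h (List.not_lt_nil _)
    | cons y b =>
      rw [List.cons_append, List.cons_append, List.cons_lt_cons_iff]
      rcases List.cons_lt_cons_iff.1 h with h1 | ⟨rfl, h2⟩
      · exact Or.inl h1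
      · exact Or.inr ⟨rfl, ih h2 (fun hh => hp (by simpa using hh))⟩

theorem append_lt_append_of_length_le {a b : List α} (h : a < b) (hl : b.length ≤ a.length)
    (s t : List α) : a ++ s < b ++ t := by
  refine append_lt_append_of_not_prefix h (fun hp => ?_) s t
  have := hp.eq_of_length (le_antisymm hp.length_le hl)
  exact absurd (this ▸ h) (lt_irrefl _)

theorem prefix_le {a b : List α} (h : a <+: b) : a ≤ b := by
  obtain ⟨s, rfl⟩ := h
  induction a with
  | nil => cases s with
    | nil => exact le_refl _
    | cons x s => exact le_of_lt (List.nil_lt_cons _ _)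
  | cons x a ih => exact List.cons_le_cons x ih

theorem isLyndon_iff_suffix {w : List α} :
    IsLyndon w ↔ w ≠ [] ∧ ∀ x y, x ≠ [] → y ≠ [] → w = x ++ y → w < y := by
  constructor
  · rintro ⟨h0, h⟩
    refine ⟨h0, fun x y hx hy hw => ?_⟩
    have key : ∀ x y : List α, x ≠ [] → y ≠ [] → w = x ++ y → w < y ++ x := by
      intro x y hx hy hw
      have := h x.length (List.length_pos_iff.2 hx)
        (by rw [hw, List.length_append]; have := List.length_pos_iff.2 hy; omega)
      rwa [hw, List.rotate_append_length_eq, ← hw] at this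
    by_contra hlt
    have hle : y ≤ w := not_lt.1 hlt
    have hlen : y.length < w.length := by
      rw [hw, List.length_append]; have := List.length_pos_iff.2 hx; omega
    have hlt' : y < w := lt_of_le_of_ne hle (fun e => by rw [e] at hlen; omega)
    by_cases hp : y <+: w
    · obtain ⟨z, hz⟩ := hp
      have hzx : z.length = x.length := by
        have := congrArg List.length (hz.trans hw)
        simp only [List.length_append] at this
        omega
      have hz0 : z ≠ [] := fun e => hx (List.length_eq_zero_iff.1 (by rw [← hzx, e]; rfl))
      have h1 := key x y hx hy hw
      have h2 := key y z hy hz0 hz.symm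
      rw [← hz] at h1
      have h3 : z < x := by
        by_contra hc
        rcases lt_or_eq_of_le (not_lt.1 hc) with hc | hc
        · exact lt_asymm h1 (List.append_left_lt hc)
        · rw [hc] at h1; exact lt_irrefl _ h1
      rw [hw] at h2
      exact lt_asymm h2 (append_lt_append_of_length_le h3 hzx.ge y y)
    · have h1 := append_lt_append_of_not_prefix hlt' hp x []
      rw [List.append_nil] at h1
      exact lt_asymm h1 (key x y hx hy hw)
  · rintro ⟨h0, h⟩
    refine ⟨h0, fun i hi hl => ?_⟩
    rw [List.rotate_eq_drop_append_take hl.le]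
    have h1 := h (w.take i) (w.drop i)
      (by rw [Ne, ← List.length_eq_zero_iff, List.length_take]; omega)
      (by rw [Ne, ← List.length_eq_zero_iff, List.length_drop]; omega)
      (List.take_append_drop i w).symm
    have h2 := append_lt_append_of_length_le h1 (by rw [List.length_drop]; omega) [] (w.take i)
    rwa [List.append_nil] at h2

theorem IsLyndon.append {u v : List α} (hu : IsLyndon u) (hv : IsLyndon v) (h : u < v) :
    IsLyndon (u ++ v) := by
  rw [isLyndon_iff_suffix] at hu hv ⊢
  have huv : u ++ v < v := by
    by_cases hp : u <+: v
    · obtain ⟨z, rfl⟩ := hp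
      have hz : z ≠ [] := fun e => by rw [e, List.append_nil] at h; exact lt_irrefl _ h
      exact List.append_left_lt (hv.2 u z hu.1 hz rfl)
    · have := append_lt_append_of_not_prefix h hp v []
      rwa [List.append_nil] at this
  refine ⟨by simp [hu.1], fun x y hx hy hw => ?_⟩
  rcases List.append_eq_append_iff.1 hw with ⟨a, rfl, rfl⟩ | ⟨a, rfl, rfl⟩
  · by_cases ha : a = []
    · subst ha; simpa using huv
    · exact huv.trans (hv.2 a y ha hy rfl)
  · by_cases ha : a = []
    · subst ha; simpa using huv
    · exact append_lt_append_of_length_le (hu.2 x a hx ha rfl) (by simp) v v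

theorem exists_lyndonFactorization_append (fs : List (List α)) (u : List α) (hu : IsLyndon u)
    (hf : ∀ f ∈ fs, IsLyndon f) (hs : fs.Pairwise (fun u v => v ≤ u)) :
    ∃ gs, IsLyndonFactorization gs (u ++ fs.flatten) := by
  induction fs generalizing u with
  | nil => exact ⟨[u], by simp [IsLyndonFactorization, hu]⟩
  | cons v vs ih =>
    have hv := hf v (by simp)
    by_cases h : u < v
    · have := ih (u ++ v) (hu.append hv h) (fun f hf' => hf f (by simp [hf'])) hs.of_cons
      simpa using this
    · refine ⟨u :: v :: vs, by simp, ?_, ?_⟩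
      · intro f hf'
        rcases List.mem_cons.1 hf' with rfl | hf'
        · exact hu
        · exact hf f hf'
      · refine List.pairwise_cons.2 ⟨fun f hf' => ?_, hs⟩
        rcases List.mem_cons.1 hf' with rfl | hf'
        · exact not_lt.1 h
        · exact ((List.pairwise_cons.1 hs).1 f hf').trans (not_lt.1 h)

theorem exists_lyndonFactorization (T : List α) : ∃ fs, IsLyndonFactorization fs T := by
  induction T with
  | nil => exact ⟨[], by simp [IsLyndonFactorization]⟩
  | cons c T ih =>
    obtain ⟨fs, rfl, h1, h2⟩ := ih
    refine exists_lyndonFactorization_append fs [c] ⟨by simp, fun i hi hl => ?_⟩ h1 h2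
    simp only [List.length_cons, List.length_nil] at hl
    omega

theorem lyndonFactorization_head_length {u v : List α} {us vs : List (List α)} {T : List α}
    (hu : IsLyndonFactorization (u :: us) T) (hv : IsLyndonFactorization (v :: vs) T) :
    v.length ≤ u.length := by
  by_contra hlt
  have hpu : u <+: T := ⟨us.flatten, by simpa using hu.1⟩
  have hpv : v <+: T := ⟨vs.flatten, by simpa using hv.1⟩
  obtain ⟨r, rfl⟩ := List.prefix_of_prefix_length_le hpu hpv (not_le.1 hlt).le
  have hr : r ≠ [] := fun e => by simp [e] at hlt
  have hpr : r <+: us.flatten := by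
    have h1 : u ++ us.flatten = T := by simpa using hu.1
    rw [← h1, List.prefix_append_right_inj] at hpv
    exact hpv
  obtain ⟨q, s, f, rfl, hs, hf, hsf⟩ := exists_suffix_prefix us r hr hpr
  have hu0 := (hu.2.1 u (by simp)).1
  have h1 := (isLyndon_iff_suffix.1 (hv.2.1 (u ++ (q ++ s)) (by simp))).2 (u ++ q) s (by simp [hu0]) hs (by simp)
  have h2 : f ≤ u := (List.pairwise_cons.1 hu.2.2).1 f hf
  have h3 : u ≤ u ++ (q ++ s) := prefix_le ⟨_, rfl⟩
  exact absurd (h1.trans_le ((prefix_le hsf).trans (h2.trans h3))) (lt_irrefl _)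

theorem lyndonFactorization_unique {us vs : List (List α)} {T : List α}
    (hu : IsLyndonFactorization us T) (hv : IsLyndonFactorization vs T) : us = vs := by
  induction us generalizing vs T with
  | nil =>
    cases vs with
    | nil => rfl
    | cons v vs =>
      exfalso
      have h := hv.1.trans hu.1.symm
      exact (hv.2.1 v (by simp)).1 (by simpa using (List.append_eq_nil_iff.1 h).1)
  | cons u us ih =>
    cases vs with
    | nil =>
      exfalso
      have h := hu.1.trans hv.1.symm
      exact (hu.2.1 u (by simp)).1 (by simpa using (List.append_eq_nil_iff.1 h).1)
    | cons v vs =>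
      have hl := le_antisymm (lyndonFactorization_head_length hv hu)
        (lyndonFactorization_head_length hu hv)
      have he : u ++ us.flatten = v ++ vs.flatten := by
        simpa using hu.1.trans hv.1.symm
      obtain ⟨rfl, h2⟩ := List.append_inj he hl
      rw [ih (vs := vs) ⟨rfl, fun f hf => hu.2.1 f (by simp [hf]), hu.2.2.of_cons⟩
        ⟨h2.symm, fun f hf => hv.2.1 f (by simp [hf]), hv.2.2.of_cons⟩]

end lyndonFacts

/-- The Lyndon factorization `T₁, …, T_t` of `T` (empty for the empty word). -/
noncomputable def lyndonFactors {α : Type*} [LinearOrder α] (T : List α) : List (List α) :=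
  (exists_lyndonFactorization T).choose

theorem lyndonFactors_spec {α : Type*} [LinearOrder α] (T : List α) :
    IsLyndonFactorization (lyndonFactors T) T :=
  (exists_lyndonFactorization T).choose_spec

/-- The order `≺_ω`: the infinite repetition `uuu⋯` is lexicographically smaller than `vvv⋯`
(used for non-empty words). -/
def OmegaLt {α : Type*} [LinearOrder α] (u v : List α) : Prop :=
  ∃ (k : ℕ) (a b : α), (∀ j < k, u[j % u.length]? = v[j % v.length]?) ∧
    u[k % u.length]? = some a ∧ v[k % v.length]? = some b ∧ a < b

/-- The list of the conjugates `conj₀(u), …, conj_{|u|-1}(u)`. -/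
def conjugates {α : Type*} (u : List α) : List (List α) :=
  (List.range u.length).map u.rotate

open Classical in
/-- The bijective Burrows-Wheeler transform: the last characters of the conjugates of all Lyndon
factors of `T` (with multiplicity), listed in `≺_ω` order. Conjugates that are equivalent
with respect to this order are equal words, so the order among them does not matter. -/
noncomputable def bbwt {α : Type*} [LinearOrder α] (T : List α) : List α :=
  (((lyndonFactors T).flatMap conjugates).mergeSort
    (fun u v => decide (¬ OmegaLt v u))).filterMap List.getLast?

/-- Words over the alphabet extended by the delimiter `$ = ⊥`, smaller than every character. -/
abbrev DWord (σ : ℕ) := List (WithBot (Fin σ))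

/-- A word without delimiter, seen over the extended alphabet. -/
def lift {σ : ℕ} (T : List (Fin σ)) : DWord σ := T.map (fun c => (c : WithBot (Fin σ)))

/-- The Burrows-Wheeler transform of `T`: the BBWT of `$T`. It has length `|T| + 1`. -/
noncomputable def bwt {σ : ℕ} (T : List (Fin σ)) : DWord σ := bbwt (⊥ :: lift T)

/-! ### The inversion algorithm on words. Positions are counted from 1. -/

/-- `rank L c j`: the number of occurrences of `c` in `L[1..j]`. -/
def rank {σ : ℕ} (L : DWord σ) (c : WithBot (Fin σ)) (j : ℕ) : ℕ := (L.take j).count c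

/-- `select L c j`: the position of the `j`-th `c` in `L` (the least `p` with
`rank L c p = j`), and `0` for `j = 0`. -/
def select {σ : ℕ} (L : DWord σ) (c : WithBot (Fin σ)) (j : ℕ) : ℕ :=
  ((List.range (L.length + 1)).find? (fun p => decide (rank L c p = j))).getD 0

/-- The word `First`: the characters of `L` in increasing order. -/
def first {σ : ℕ} (L : DWord σ) : DWord σ := L.mergeSort (fun a b => decide (a ≤ b))

/-- The forward step `FL[i] = L.select_{First[i]}(First.rank_{First[i]}(i))`. -/
def FL {σ : ℕ} (L : DWord σ) (i : ℕ) : ℕ :=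
  match (first L)[i - 1]? with
  | some c => select L c (rank (first L) c i)
  | none => 0

/-- State of the inner loop: the current transform, the position of `$` in it, the characters
output so far for the current factor. -/
structure InvState (σ : ℕ) where
  text : DWord σ
  pos : ℕ
  out : DWord σ

/-- Start of the extraction of a factor: `$` is inserted at position 2. -/
def invStart {σ : ℕ} (L : DWord σ) : InvState σ := ⟨L.insertIdx 1 ⊥, 2, []⟩

/-- One inversion step: with `p' = FL[p]`, output `L[p']`, set `L[p'] ← $`, delete `L[p]`, and move
`p` to the place where `$` is stored now. -/
def invStep {σ : ℕ} (s : InvState σ) : InvState σ :=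
  let p' := FL s.text s.pos
  { text := (s.text.set (p' - 1) ⊥).eraseIdx (s.pos - 1)
    pos := if s.pos < p' then p' - 1 else p'
    out := s.out ++ s.text[p' - 1]?.toList }

/-- `Extracts L fs`: the inversion algorithm, started with the word `L`, terminates and extracts
the words `fs`, in this order. As long as `L` is not empty, one round inserts `$` at position 2,
performs inversion steps while the position of `$` is not 1 (in total `k` steps), emits
the output of these steps, and deletes the first entry. -/
inductive Extracts {σ : ℕ} : DWord σ → List (DWord σ) → Prop
  | done : Extracts [] []
  | round (L : DWord σ) (k : ℕ) (fs : List (DWord σ)) (hL : L ≠ [])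
      (hrun : ∀ i < k, (invStep^[i] (invStart L)).pos ≠ 1)
      (hend : (invStep^[k] (invStart L)).pos = 1)
      (hrest : Extracts ((invStep^[k] (invStart L)).text.eraseIdx 0) fs) :
      Extracts L ((invStep^[k] (invStart L)).out :: fs)

/-! ### The word RAM -/

inductive BinOp
  | add | sub | mul | div | mod | and | or | xor | shl | shr

/-- Arithmetic on words of `w` bits, modulo `2 ^ w`. -/
def BinOp.eval (w : ℕ) : BinOp → ℕ → ℕ → ℕ
  | .add, a, b => (a + b) % 2 ^ w
  | .sub, a, b => (a + 2 ^ w - b) % 2 ^ w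
  | .mul, a, b => (a * b) % 2 ^ w
  | .div, a, b => a / b
  | .mod, a, b => a % b
  | .and, a, b => a &&& b
  | .or, a, b => a ||| b
  | .xor, a, b => a ^^^ b
  | .shl, a, b => (a <<< b) % 2 ^ w
  | .shr, a, b => a >>> b

/-- Instructions of a word RAM with the registers `0, …, K`, each of unit cost. -/
inductive Instr (K : ℕ)
  /-- `R[d] ← c mod 2 ^ w` -/
  | const (d : Fin (K + 1)) (c : ℕ)
  /-- `R[d] ← R[a]` -/
  | move (d a : Fin (K + 1))
  /-- `R[d] ← R[a] o R[b]` -/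
  | op (o : BinOp) (d a b : Fin (K + 1))
  /-- `R[d] ← M[R[a]]` -/
  | load (d a : Fin (K + 1))
  /-- `M[R[a]] ← R[b]` -/
  | store (a b : Fin (K + 1))
  /-- `goto target` -/
  | jump (target : ℕ)
  /-- `if R[a] < R[b] then goto target` -/
  | jumpLt (a b : Fin (K + 1)) (target : ℕ)
  /-- `if R[a] = R[b] then goto target` -/
  | jumpEq (a b : Fin (K + 1)) (target : ℕ)

abbrev Program (K : ℕ) := List (Instr K)

/-- Configuration: program counter, registers, and the memory cells that hold the input (cells
are numbered from 0; there is no other memory). -/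
structure Config (K : ℕ) where
  pc : ℕ
  reg : Fin (K + 1) → ℕ
  mem : List ℕ

/-- One step; `none` if there is no instruction to execute (the machine has halted) or a memory access
is out of bounds. -/
def step {K : ℕ} (w : ℕ) (prog : Program K) (c : Config K) : Option (Config K) :=
  match prog[c.pc]? with
  | none => none
  | some (.const d v) => some ⟨c.pc + 1, Function.update c.reg d (v % 2 ^ w), c.mem⟩
  | some (.move d a) => some ⟨c.pc + 1, Function.update c.reg d (c.reg a), c.mem⟩
  | some (.op o d a b) =>
      some ⟨c.pc + 1, Function.update c.reg d (o.eval w (c.reg a) (c.reg b)), c.mem⟩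
  | some (.load d a) =>
      (c.mem[c.reg a]?).map fun v => ⟨c.pc + 1, Function.update c.reg d v, c.mem⟩
  | some (.store a b) =>
      if c.reg a < c.mem.length then some ⟨c.pc + 1, c.reg, c.mem.set (c.reg a) (c.reg b)⟩
      else none
  | some (.jump t) => some ⟨t, c.reg, c.mem⟩
  | some (.jumpLt a b t) => some ⟨if c.reg a < c.reg b then t else c.pc + 1, c.reg, c.mem⟩
  | some (.jumpEq a b t) => some ⟨if c.reg a = c.reg b then t else c.pc + 1, c.reg, c.mem⟩

/-- The configuration after `s` steps, `none` if the machine has stopped earlier. -/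
def run {K : ℕ} (w : ℕ) (prog : Program K) (c : Config K) : ℕ → Option (Config K)
  | 0 => some c
  | s + 1 => (run w prog c s).bind (step w prog)

/-- The number stored in a memory cell for a symbol: `$` is `0`, the character `c` is `c + 1`. -/
def code {σ : ℕ} : WithBot (Fin σ) → ℕ
  | ⊥ => 0
  | (c : Fin σ) => c + 1

/-- Initial configuration: the input, one symbol per cell, and the number of cells in register `0`. -/
def initConfig {σ : ℕ} (K : ℕ) (input : DWord σ) : Config K :=
  ⟨0, fun r => if r = 0 then input.length else 0, input.map code⟩

/-- The space restriction of in-place algorithms: besides the memory cells of the input, which can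
hold nothing but a word over the alphabet with at most one `$`, at most `bits` bits are in use. -/
def Config.InPlace {K : ℕ} (c : Config K) (σ bits : ℕ) : Prop :=
  (∀ v ∈ c.mem, v ≤ σ) ∧ c.mem.count 0 ≤ 1 ∧ ∑ r, (c.reg r).size ≤ bits

/-- On words of `w` bits, `prog` transforms `input` into `output` in at most `time` steps, in place
with `bits` bits of working space, and in the course of the computation the memory holds
`stage 0, …, stage t` at increasing times. -/
def TransformsInPlace {K : ℕ} (prog : Program K) (w : ℕ) {σ : ℕ} (input output : DWord σ)
    (time bits : ℕ) (t : ℕ) (stage : ℕ → DWord σ) : Prop :=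
  ∃ s ≤ time,
    (∀ i ≤ s, ∃ c, run w prog (initConfig K input) i = some c ∧ c.InPlace σ bits) ∧
    (∃ c, run w prog (initConfig K input) s = some c ∧ c.pc = prog.length ∧
      c.mem = output.map code) ∧
    ∃ τ : ℕ → ℕ, (∀ j < t, τ j < τ (j + 1)) ∧ τ t ≤ s ∧
      ∀ j ≤ t, ∃ c, run w prog (initConfig K input) (τ j) = some c ∧ c.mem = (stage j).map code

end BBWT

namespace BBWT

/-! A conjugate enters the transform only through its infinite repetition, the key, and its last
character. Such pairs are rows, and the transform reads the last characters off a sorted multiset of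
rows (`bwtOf`). Among conjugates the key determines the last character (`consistent_factorRows`), so
ties are harmless. The rows of a factor `F` have the keys `v F F F ⋯` for the proper suffixes `v` of
`F`, each with the character in front of `v`. Extending every key of complete factors by its last
character only permutes the keys (`extensions_factorRows`). The number of extended keys below `c x`
is the number of smaller characters plus a rank of `c` (`countLt_add_count`); this is the LF
mapping.

The last factor `F` is the smallest one, hence `F F F ⋯` is at most every tail of every key.
Replacing it by `⊥ ⊥ ⊥ ⋯` in the keys belonging to `F` therefore does not change the transform
(`bwtOf_innerRows_bots`). So the BBWT of `T_1 ⋯ T_x` is that of `T_1 ⋯ T_{x-1} $ T_x` without its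
`$`, and this `$` belongs at position 2, since only `$ $ $ ⋯` is smaller than `T_x $ $ ⋯`
(`delimPos_of_isLyndon`). Prepending `c` to the word behind `$` means overwriting `$` by `c` and
inserting a new `$` at the LF rank (`delimText_cons`, `delimPos_cons`). A step of the algorithm is
the inverse of that (`invStep_eq`), and `$` reaches position 1 exactly when the word behind it is
empty.

The RAM program works in the opposite direction and without `$` in the remaining transform: it
follows LF from the last character of `F` to the first, deleting each row that it leaves. If `F = u
c v` and the rows left for `F` are those of `u c`, then their extensions, with those of the other
factors, are the keys that remain after the deletion, and `F F F ⋯`. Hence the LF count exceeds the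
next rank by one, and it is zero exactly when `F` is exhausted (`extraction_step`). A step takes two
scans and one shift of cells. The extracted character is prepended to the plain text stored behind
the transform or, by the same rule for prepending to `$ s`, to a BWT stored there. -/

/-! ### Infinite words in lexicographic order -/

/-- Infinite words, ordered lexicographically. -/
def Inf (β : Type*) := Lex (ℕ → β)

noncomputable instance {β : Type*} [LinearOrder β] : LinearOrder (Inf β) :=
  inferInstanceAs (LinearOrder (Lex (ℕ → β)))

set_option linter.unusedSectionVars false

section infinite

variable {β : Type*} [LinearOrder β]

theorem Inf.lt_iff {x y : Inf β} : x < y ↔ ∃ k, (∀ j < k, x j = y j) ∧ x k < y k := Iff.rfl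

/-- The infinite word `a x`. -/
def icons (a : β) (x : Inf β) : Inf β := toLex fun n => n.casesOn a x

@[simp] theorem icons_succ (a : β) (x : Inf β) (n : ℕ) : icons a x (n + 1) = x n := rfl

theorem icons_lt {a b : β} {x y : Inf β} :
    icons a x < icons b y ↔ a < b ∨ a = b ∧ x < y := by
  simp only [Inf.lt_iff]
  constructor
  · rintro ⟨k, h1, h2⟩
    cases k with
    | zero => exact Or.inl h2
    | succ k =>
      exact Or.inr ⟨h1 0 (by omega), k, fun j hj => h1 (j + 1) (by omega), h2⟩
  · rintro (h | ⟨rfl, k, h1, h2⟩)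
    · exact ⟨0, by simp, h⟩
    · refine ⟨k + 1, fun j hj => ?_, h2⟩
      cases j with
      | zero => rfl
      | succ j => exact h1 j (by omega)

theorem icons_le {a b : β} {x y : Inf β} :
    icons a x ≤ icons b y ↔ a < b ∨ a = b ∧ x ≤ y := by
  rw [← not_lt, icons_lt, ← not_lt (a := y), not_or, not_and, not_lt]
  constructor
  · rintro ⟨h1, h2⟩
    rcases h1.lt_or_eq with h | h
    · exact Or.inl h
    · exact Or.inr ⟨h, h2 h.symm⟩
  · rintro (h | ⟨h, h2⟩)
    · exact ⟨h.le, fun h' => absurd h'.symm h.ne⟩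
    · exact ⟨h.le, fun _ => h2⟩

/-- The infinite word without its first `n` characters. -/
def idrop (n : ℕ) (x : Inf β) : Inf β := toLex fun i => x (n + i)

theorem idrop_zero (x : Inf β) : idrop 0 x = x := by
  funext i; exact congrArg x (Nat.zero_add i)

theorem idrop_idrop (m n : ℕ) (x : Inf β) : idrop m (idrop n x) = idrop (n + m) x := by
  funext i; exact congrArg x (by omega)

theorem icons_idrop (x : Inf β) : icons (x 0) (idrop 1 x) = x := by
  funext n
  cases n with
  | zero => rfl
  | succ n => exact congrArg x (by omega)

/-- The infinite word `u x`. -/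
def iapp (u : List β) (x : Inf β) : Inf β := u.foldr icons x

@[simp] theorem iapp_nil (x : Inf β) : iapp [] x = x := rfl

@[simp] theorem iapp_cons (a : β) (u : List β) (x : Inf β) :
    iapp (a :: u) x = icons a (iapp u x) := rfl

theorem iapp_append (u v : List β) (x : Inf β) : iapp (u ++ v) x = iapp u (iapp v x) := by
  simp [iapp]

theorem iapp_lt {u : List β} {x y : Inf β} : iapp u x < iapp u y ↔ x < y := by
  induction u with
  | nil => rfl
  | cons a u ih => simp [icons_lt, ih]

theorem iapp_le {u : List β} {x y : Inf β} : iapp u x ≤ iapp u y ↔ x ≤ y := by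
  rw [← not_lt, iapp_lt, not_lt]

theorem iapp_apply_lt {u : List β} (x : Inf β) {n : ℕ} (h : n < u.length) :
    iapp u x n = u[n] := by
  induction u generalizing n with
  | nil => simp at h
  | cons a u ih =>
    cases n with
    | zero => rfl
    | succ n => exact ih (by simpa using h)

theorem iapp_apply_ge {u : List β} (x : Inf β) {n : ℕ} (h : u.length ≤ n) :
    iapp u x n = x (n - u.length) := by
  induction u generalizing n with
  | nil => rfl
  | cons a u ih =>
    cases n with
    | zero => simp at h
    | succ n =>
      have := ih (n := n) (by simpa using h)
      simpa using this

theorem iapp_lt_iapp_of_not_prefix {u v : List β} (h : u < v) (hp : ¬ u <+: v) (x y : Inf β) :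
    iapp u x < iapp v y := by
  induction u generalizing v with
  | nil => exact absurd List.nil_prefix hp
  | cons a u ih =>
    cases v with
    | nil => exact absurd h (List.not_lt_nil _)
    | cons b v =>
      rw [iapp_cons, iapp_cons, icons_lt]
      rcases List.cons_lt_cons_iff.1 h with h1 | ⟨rfl, h2⟩
      · exact Or.inl h1
      · exact Or.inr ⟨rfl, ih h2 fun hh => hp (by simpa using hh)⟩

variable [OrderBot β]

/-- The infinite word `⊥⊥⊥⋯`. -/
def bots : Inf β := toLex fun _ => ⊥

theorem icons_bots : icons ⊥ bots = (bots : Inf β) := by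
  funext n; cases n <;> rfl

theorem bots_le (x : Inf β) : bots ≤ x := by
  rw [← not_lt, Inf.lt_iff]
  rintro ⟨k, -, h⟩
  exact not_lt_bot h

/-- The infinite repetition `uuu⋯` of a non-empty word. -/
def omega (u : List β) : Inf β := toLex fun n => u.getD (n % u.length) ⊥

theorem omega_apply {u : List β} (n : ℕ) (h : n % u.length < u.length) :
    omega u n = u[n % u.length] := by
  show u.getD _ _ = _
  rw [List.getD_eq_getElem _ _ h]

theorem omega_apply' {u : List β} (hu : u ≠ []) (n : ℕ) :
    u[n % u.length]? = some (omega u n) := by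
  have h : n % u.length < u.length := Nat.mod_lt _ (List.length_pos_iff.2 hu)
  rw [omega_apply n h, List.getElem?_eq_getElem h]

theorem omega_ext {u : List β} (hu : u ≠ []) {x : Inf β}
    (h : ∀ n, u[n % u.length]? = some (x n)) : omega u = x := by
  funext n
  have := (omega_apply' hu n).symm.trans (h n)
  simpa using this

theorem omegaLt_iff {u v : List β} (hu : u ≠ []) (hv : v ≠ []) :
    OmegaLt u v ↔ omega u < omega v := by
  simp only [OmegaLt, omega_apply' hu, omega_apply' hv, Inf.lt_iff, Option.some.injEq]
  constructor
  · rintro ⟨k, a, b, h1, rfl, rfl, h2⟩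
    exact ⟨k, h1, h2⟩
  · rintro ⟨k, h1, h2⟩
    exact ⟨k, _, _, h1, rfl, rfl, h2⟩

theorem iapp_omega {u : List β} (hu : u ≠ []) : iapp u (omega u) = omega u := by
  symm
  apply omega_ext hu
  intro n
  by_cases h : n < u.length
  · rw [iapp_apply_lt _ h, Nat.mod_eq_of_lt h, List.getElem?_eq_getElem h]
  · rw [iapp_apply_ge _ (not_lt.1 h), ← omega_apply' hu, Nat.mod_eq_sub_mod (not_lt.1 h)]

theorem omega_rotate {u : List β} (hu : u ≠ []) (i : ℕ) :
    omega (u.rotate i) = idrop i (omega u) := by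
  apply omega_ext (by simpa using hu)
  intro n
  have h : 0 < u.length := List.length_pos_iff.2 hu
  rw [List.length_rotate, List.getElem?_rotate (Nat.mod_lt _ h)]
  show _ = some (omega u (i + n))
  rw [← omega_apply' hu, Nat.mod_add_mod, Nat.add_comm]

theorem idrop_iapp (u : List β) (x : Inf β) : idrop u.length (iapp u x) = x := by
  funext n
  show iapp u x (u.length + n) = _
  rw [iapp_apply_ge _ (by omega)]
  exact congrArg x (by omega)

theorem omega_rotate_eq_iapp {u : List β} (hu : u ≠ []) {i : ℕ} (hi : i ≤ u.length) :
    omega (u.rotate i) = iapp (u.drop i) (omega u) := by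
  rw [omega_rotate hu]
  conv_lhs => rw [← iapp_omega hu, ← List.take_append_drop i u, iapp_append,
    List.take_append_drop]
  have := idrop_iapp (u.take i) (iapp (u.drop i) (omega u))
  rwa [List.length_take, min_eq_left hi] at this

theorem omega_lt_of_lt {u v : List β} (hl : u.length = v.length) (h : u < v) :
    omega u < omega v := by
  have hu : u ≠ [] := by
    rintro rfl
    have : v = [] := List.length_eq_zero_iff.1 hl.symm
    exact absurd (this ▸ h) (lt_irrefl _)
  have hv : v ≠ [] := by
    rintro rfl; exact hu (List.length_eq_zero_iff.1 hl)
  rw [← iapp_omega hu, ← iapp_omega hv]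
  exact iapp_lt_iapp_of_not_prefix h (fun hp => absurd (hp.eq_of_length hl) h.ne) _ _

theorem IsLyndon.omega_lt_rotate {u : List β} (hu : IsLyndon u) {i : ℕ} (h0 : 0 < i)
    (hi : i < u.length) : omega u < omega (u.rotate i) :=
  omega_lt_of_lt (by simp) (hu.2 i h0 hi)

theorem IsLyndon.omega_le_idrop {u : List β} (hu : IsLyndon u) (i : ℕ) :
    omega u ≤ idrop i (omega u) := by
  rw [← omega_rotate hu.1, ← List.rotate_mod]
  rcases Nat.eq_zero_or_pos (i % u.length) with h | h
  · rw [h, List.rotate_zero]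
  · exact (hu.omega_lt_rotate h (Nat.mod_lt _ (List.length_pos_iff.2 hu.1))).le

/-- Up to the first difference `k`, the word `y` agrees with `omega u`; as `u` is non-empty, `u y`
then agrees with `omega u` even at position `k`. -/
theorem lt_iapp_of_lt_omega {u : List β} (hu : u ≠ []) {y : Inf β} (h : y < omega u) :
    y < iapp u y := by
  obtain ⟨k, h1, h2⟩ := h
  have key : ∀ j ≤ k, iapp u y j = omega u j := by
    intro j hj
    rw [← iapp_omega hu]
    by_cases hl : j < u.length
    · rw [iapp_apply_lt _ hl, iapp_apply_lt _ hl]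
    · have := List.length_pos_iff.2 hu
      rw [iapp_apply_ge _ (not_lt.1 hl), iapp_apply_ge _ (not_lt.1 hl)]
      exact h1 _ (by omega)
  exact ⟨k, fun j hj => (h1 j hj).trans (key j hj.le).symm, by
    have := key k le_rfl
    show y k < iapp u y k
    rw [this]; exact h2⟩

/-- The delicate case is `v = u z`. There `v < z` gives `u v v v ⋯ < v v v ⋯`, so `omega v < omega
u` would contradict `lt_iapp_of_lt_omega`. -/
theorem IsLyndon.omega_le_omega {u v : List β} (hu : IsLyndon u) (hv : IsLyndon v) (h : u ≤ v) :
    omega u ≤ omega v := by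
  rcases h.eq_or_lt with rfl | h
  · exact le_rfl
  by_cases hp : u <+: v
  · obtain ⟨z, rfl⟩ := hp
    have hz : z ≠ [] := by
      rintro rfl
      simp at h
    have hvz := (isLyndon_iff_suffix.1 hv).2 u z hu.1 hz rfl
    have hlt : iapp u (omega (u ++ z)) < omega (u ++ z) := by
      conv_rhs => rw [← iapp_omega hv.1, iapp_append]
      rw [iapp_lt]
      conv_lhs => rw [← iapp_omega hv.1]
      refine iapp_lt_iapp_of_not_prefix hvz (fun hp => ?_) _ _
      have h1 := hp.length_le
      have h2 := List.length_pos_iff.2 hu.1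
      simp at h1
      exact hu.1 h1
    by_contra hc
    exact lt_asymm hlt (lt_iapp_of_lt_omega hu.1 (not_le.1 hc))
  · rw [← iapp_omega hu.1, ← iapp_omega hv.1]
    exact (iapp_lt_iapp_of_not_prefix h hp _ _).le

end infinite

/-! ### Transforms of multisets of rows -/

section rows

variable {β : Type*} [LinearOrder β]

/-- A row: a conjugate, represented by its infinite repetition, and its last character. -/
abbrev Row (β : Type*) := Inf β ×ₗ β

/-- A row from its two components. -/
abbrev row (x : Inf β) (c : β) : Row β := toLex (x, c)

/-- The last characters of the sorted rows. -/
noncomputable def bwtOf (D : Multiset (Row β)) : List β := D.sort.map fun ρ => (ofLex ρ).2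

theorem row_lt {x y : Inf β} {c d : β} : row x c < row y d ↔ x < y ∨ x = y ∧ c < d :=
  Prod.Lex.toLex_lt_toLex

theorem row_le {x y : Inf β} {c d : β} : row x c ≤ row y d ↔ x < y ∨ x = y ∧ c ≤ d :=
  Prod.Lex.toLex_le_toLex

theorem sort_coe_eq {ι : Type*} [LinearOrder ι] {l : List ι} (h : l.Pairwise (· ≤ ·)) :
    (l : Multiset ι).sort = l := by
  rw [Multiset.coe_sort]
  exact List.mergeSort_eq_self _ h

theorem bwtOf_coe {l : List (Row β)} (h : l.Pairwise (· ≤ ·)) :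
    bwtOf (l : Multiset (Row β)) = l.map fun ρ => (ofLex ρ).2 := by
  rw [bwtOf, sort_coe_eq h]

theorem length_bwtOf (D : Multiset (Row β)) : (bwtOf D).length = D.card := by
  simp [bwtOf]

theorem coe_bwtOf (D : Multiset (Row β)) :
    (bwtOf D : Multiset β) = D.map fun ρ => (ofLex ρ).2 := by
  rw [bwtOf, ← Multiset.map_coe, Multiset.sort_eq]

theorem countP_bwtOf (D : Multiset (Row β)) (p : β → Prop) [DecidablePred p] :
    (bwtOf D).countP (fun c => decide (p c)) = D.countP fun ρ => p (ofLex ρ).2 := by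
  rw [← Multiset.coe_countP, coe_bwtOf, Multiset.countP_map, Multiset.countP_eq_card_filter]

/-- The part of the sorted rows below a given one. -/
noncomputable def lowerRows (D : Multiset (Row β)) (ρ : Row β) : List (Row β) :=
  (D.filter (· < ρ)).sort

/-- The part of the sorted rows not below a given one. -/
noncomputable def upperRows (D : Multiset (Row β)) (ρ : Row β) : List (Row β) :=
  (D.filter (¬ · < ρ)).sort

theorem sorted_insert (D : Multiset (Row β)) (ρ : Row β) :
    (lowerRows D ρ ++ ρ :: upperRows D ρ).Pairwise (· ≤ ·) := by
  rw [List.pairwise_append]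
  refine ⟨Multiset.pairwise_sort _ _, List.pairwise_cons.2 ⟨fun b hb => ?_,
    Multiset.pairwise_sort _ _⟩, fun a ha b hb => ?_⟩
  · have := (Multiset.mem_filter.1 ((Multiset.mem_sort _).1 hb)).2
    exact not_lt.1 this
  · have h1 := (Multiset.mem_filter.1 ((Multiset.mem_sort _).1 ha)).2
    rcases List.mem_cons.1 hb with rfl | hb
    · exact h1.le
    · have h2 := (Multiset.mem_filter.1 ((Multiset.mem_sort _).1 hb)).2
      exact h1.le.trans (not_lt.1 h2)

theorem sort_eq_append (D : Multiset (Row β)) (ρ : Row β) :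
    D.sort = lowerRows D ρ ++ upperRows D ρ := by
  have h := (sorted_insert D ρ).sublist
    (List.Sublist.append_left (List.sublist_cons_self ρ (upperRows D ρ)) _)
  rw [← sort_coe_eq h]
  congr 1
  rw [← Multiset.coe_add, lowerRows, upperRows, Multiset.sort_eq, Multiset.sort_eq,
    Multiset.filter_add_not]

theorem sort_cons_eq_append (D : Multiset (Row β)) (ρ : Row β) :
    (ρ ::ₘ D).sort = lowerRows D ρ ++ ρ :: upperRows D ρ := by
  rw [← sort_coe_eq (sorted_insert D ρ)]
  congr 1
  rw [← Multiset.coe_add, ← Multiset.cons_coe, lowerRows, upperRows, Multiset.sort_eq,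
    Multiset.sort_eq, Multiset.add_cons, Multiset.filter_add_not]

/-- The number of rows below a given one. -/
noncomputable def rowRank (D : Multiset (Row β)) (ρ : Row β) : ℕ := D.countP (· < ρ)

theorem length_lowerRows (D : Multiset (Row β)) (ρ : Row β) :
    (lowerRows D ρ).length = rowRank D ρ := by
  rw [lowerRows, Multiset.length_sort, rowRank, Multiset.countP_eq_card_filter]

theorem rowRank_le (D : Multiset (Row β)) (ρ : Row β) : rowRank D ρ ≤ (bwtOf D).length := by
  rw [length_bwtOf]; exact Multiset.countP_le_card _ _

theorem insertIdx_append_length {ι : Type*} (l m : List ι) (a : ι) :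
    (l ++ m).insertIdx l.length a = l ++ a :: m := by
  induction l with
  | nil => simp
  | cons b l ih => simp [ih]

theorem bwtOf_cons (D : Multiset (Row β)) (x : Inf β) (c : β) :
    bwtOf (row x c ::ₘ D) = (bwtOf D).insertIdx (rowRank D (row x c)) c := by
  rw [bwtOf, bwtOf, sort_cons_eq_append, sort_eq_append D (row x c), List.map_append,
    List.map_append, ← length_lowerRows, ← List.length_map (fun ρ : Row β => (ofLex ρ).2),
    insertIdx_append_length]
  rfl

theorem take_bwtOf (D : Multiset (Row β)) (ρ : Row β) :
    (bwtOf D).take (rowRank D ρ) = (lowerRows D ρ).map fun ρ => (ofLex ρ).2 := by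
  rw [bwtOf, sort_eq_append D ρ, List.map_append, ← length_lowerRows,
    ← List.length_map (fun ρ : Row β => (ofLex ρ).2), List.take_left]

theorem count_take_bwtOf [DecidableEq β] (D : Multiset (Row β)) (x : Inf β) (c : β) :
    ((bwtOf D).take (rowRank D (row x c))).count c =
      D.countP fun ρ => (ofLex ρ).2 = c ∧ (ofLex ρ).1 < x := by
  rw [take_bwtOf, ← Multiset.coe_count, ← Multiset.map_coe, lowerRows, Multiset.sort_eq,
    Multiset.count_map, Multiset.filter_filter, Multiset.countP_eq_card_filter]
  congr 1
  refine Multiset.filter_congr fun ρ _ => ?_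
  constructor
  · rintro ⟨rfl, h⟩
    refine ⟨rfl, ?_⟩
    rcases (row_lt (x := (ofLex ρ).1) (c := (ofLex ρ).2)).1 h with h | h
    · exact h
    · exact absurd h.2 (lt_irrefl _)
  · rintro ⟨rfl, h⟩
    exact ⟨rfl, (row_lt (x := (ofLex ρ).1) (c := (ofLex ρ).2)).2 (Or.inl h)⟩

/-- The number of characters of `L` smaller than `c`. -/
def countLt (L : List β) (c : β) : ℕ := L.countP fun a => decide (a < c)

/-- The LF mapping counts the rows below the extension of a row by its last character. -/
theorem countLt_add_count [DecidableEq β] (D : Multiset (Row β)) (x : Inf β) (c : β) :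
    countLt (bwtOf D) c + ((bwtOf D).take (rowRank D (row x c))).count c =
      (D.map fun ρ => icons (ofLex ρ).2 (ofLex ρ).1).countP (· < icons c x) := by
  rw [countLt, countP_bwtOf D (· < c), count_take_bwtOf, Multiset.countP_map,
    Multiset.countP_eq_card_filter, Multiset.countP_eq_card_filter, ← Multiset.card_add,
    Multiset.filter_add_filter]
  have h0 : D.filter (fun ρ => (ofLex ρ).2 < c ∧ (ofLex ρ).2 = c ∧ (ofLex ρ).1 < x) = 0 := by
    rw [Multiset.filter_eq_nil]
    rintro ρ - ⟨h1, h2, -⟩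
    exact absurd h1 (by rw [h2]; exact lt_irrefl _)
  rw [h0, add_zero]
  congr 1
  refine Multiset.filter_congr fun ρ _ => ?_
  rw [icons_lt]

/-- Rows are consistent if the infinite word determines the last character. -/
def Consistent (D : Multiset (Row β)) : Prop :=
  ∀ ρ ∈ D, ∀ ρ' ∈ D, (ofLex ρ).1 = (ofLex ρ').1 → (ofLex ρ).2 = (ofLex ρ').2

theorem Consistent.mono {D E : Multiset (Row β)} (h : Consistent E) (hs : D ≤ E) :
    Consistent D := fun ρ hρ ρ' hρ' =>
  h ρ (Multiset.mem_of_le hs hρ) ρ' (Multiset.mem_of_le hs hρ')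

theorem rowRank_eq {D : Multiset (Row β)} {x : Inf β} {c : β}
    (h : ∀ ρ ∈ D, (ofLex ρ).1 = x → c ≤ (ofLex ρ).2) :
    rowRank D (row x c) = (D.map fun ρ => (ofLex ρ).1).countP (· < x) := by
  rw [rowRank, Multiset.countP_map, Multiset.countP_eq_card_filter]
  congr 1
  refine Multiset.filter_congr fun ρ hρ => ?_
  rw [← toLex_ofLex ρ, row_lt]
  constructor
  · rintro (h' | ⟨h1, h2⟩)
    · exact h'
    · exact absurd h2 (not_lt.2 (h ρ hρ h1))
  · exact Or.inl

theorem rowRank_eq_of_consistent {D : Multiset (Row β)} {x : Inf β} {c : β}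
    (h : Consistent (row x c ::ₘ D)) :
    rowRank D (row x c) = (D.map fun ρ => (ofLex ρ).1).countP (· < x) :=
  rowRank_eq fun ρ hρ h1 => (h ρ (by simp [hρ]) (row x c) (by simp) h1).ge

/-- Sorting by the keys alone is enough, because rows with equal keys carry equal characters. This
connects `bwtOf` with `bbwt`, which sorts by `≺_ω` only. -/
theorem bwtOf_coe_of_consistent {l : List (Row β)}
    (h : l.Pairwise fun ρ ρ' => (ofLex ρ).1 ≤ (ofLex ρ').1)
    (hc : Consistent (l : Multiset (Row β))) :
    bwtOf (l : Multiset (Row β)) = l.map fun ρ => (ofLex ρ).2 := by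
  refine bwtOf_coe (h.imp_of_mem fun {ρ ρ'} h1 h2 h3 => ?_)
  rcases h3.lt_or_eq with h3 | h3
  · exact row_le.2 (Or.inl h3)
  · exact row_le.2 (Or.inr ⟨h3, (hc ρ h1 ρ' h2 h3).le⟩)

/-- Replacing the infinite words of the rows monotonically does not change the transform. -/
theorem bwtOf_congr {ι : Type*} (s : Multiset ι) (k k' : ι → Inf β) (c : ι → β)
    (hk : ∀ i ∈ s, ∀ j ∈ s, k i ≤ k j → k' i ≤ k' j)
    (hc : Consistent (s.map fun i => row (k' i) (c i))) :
    bwtOf (s.map fun i => row (k i) (c i)) = bwtOf (s.map fun i => row (k' i) (c i)) := by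
  classical
  induction s using Quotient.inductionOn with | _ l => ?_
  set r : ι → ι → Prop := fun i j => row (k i) (c i) ≤ row (k j) (c j) with hr
  -- One order of the indices serves both families: it sorts the rows for `k`, hence weakly sorts
  -- the keys `k'`, and consistency takes care of new ties.
  set m := l.insertionSort r with hm
  have hp : m.Perm l := List.perm_insertionSort r l
  have : Std.Total r := ⟨fun i j => le_total _ _⟩
  have : IsTrans ι r := ⟨fun i j k => le_trans⟩
  have hs : m.Pairwise r := List.pairwise_insertionSort r l
  have he : (⟦l⟧ : Multiset ι) = (m : Multiset ι) := (Multiset.coe_eq_coe.2 hp).symm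
  rw [he] at hk hc ⊢
  rw [Multiset.map_coe, Multiset.map_coe, bwtOf_coe (List.pairwise_map.2 hs),
    bwtOf_coe_of_consistent (List.pairwise_map.2 ?_) (by simpa using hc)]
  · simp
  · refine hs.imp_of_mem fun {i j} hi hj hij => ?_
    refine hk i hi j hj ?_
    rcases row_le.1 hij with h | h
    · exact h.le
    · exact h.1.le

end rows

/-! ### The rows of a Lyndon factorization -/

section factors

variable {β : Type*} [LinearOrder β]

/-- The proper suffixes of a word with the characters that precede them. -/
def inner : List β → List (List β × β)
  | [] => []
  | c :: u => (u, c) :: inner u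

/-- The rows `v z`, for the proper suffixes `v` of `u`. -/
noncomputable def innerRows (u : List β) (z : Inf β) : Multiset (Row β) :=
  ((inner u).map fun p => row (iapp p.1 z) p.2 : List (Row β))

@[simp] theorem innerRows_nil (z : Inf β) : innerRows [] z = 0 := rfl

@[simp] theorem innerRows_cons (c : β) (u : List β) (z : Inf β) :
    innerRows (c :: u) z = row (iapp u z) c ::ₘ innerRows u z := rfl

theorem innerRows_append (u v : List β) (z : Inf β) :
    innerRows (u ++ v) z = innerRows u (iapp v z) + innerRows v z := by
  induction u with
  | nil => simp
  | cons c u ih => simp [ih, iapp_append]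

theorem card_innerRows (u : List β) (z : Inf β) : (innerRows u z).card = u.length := by
  induction u with
  | nil => rfl
  | cons c u ih => simp [ih]

theorem mem_inner {u : List β} {p : List β × β} (h : p ∈ inner u) :
    ∃ t, u = t ++ p.2 :: p.1 := by
  induction u with
  | nil => simp [inner] at h
  | cons c u ih =>
    rcases List.mem_cons.1 h with rfl | h
    · exact ⟨[], rfl⟩
    · obtain ⟨t, rfl⟩ := ih h
      exact ⟨c :: t, rfl⟩

theorem mem_innerRows {u : List β} {z : Inf β} {ρ : Row β} (h : ρ ∈ innerRows u z) :
    ∃ t c v, u = t ++ c :: v ∧ ρ = row (iapp v z) c := by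
  obtain ⟨p, hp, rfl⟩ := List.mem_map.1 (Multiset.mem_coe.1 h)
  obtain ⟨t, ht⟩ := mem_inner hp
  exact ⟨t, p.2, p.1, ht, rfl⟩

/-- The infinite words of the rows. -/
noncomputable def keys (D : Multiset (Row β)) : Multiset (Inf β) := D.map fun ρ => (ofLex ρ).1

/-- The infinite words of the rows, extended to the left by the last characters. -/
noncomputable def extensions (D : Multiset (Row β)) : Multiset (Inf β) :=
  D.map fun ρ => icons (ofLex ρ).2 (ofLex ρ).1

@[simp] theorem keys_zero : keys (0 : Multiset (Row β)) = 0 := rfl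

@[simp] theorem keys_cons (x : Inf β) (c : β) (D : Multiset (Row β)) :
    keys (row x c ::ₘ D) = x ::ₘ keys D := Multiset.map_cons _ _ _

@[simp] theorem extensions_cons (x : Inf β) (c : β) (D : Multiset (Row β)) :
    extensions (row x c ::ₘ D) = icons c x ::ₘ extensions D := Multiset.map_cons _ _ _

@[simp] theorem keys_add (D E : Multiset (Row β)) : keys (D + E) = keys D + keys E :=
  Multiset.map_add _ _ _

@[simp] theorem extensions_add (D E : Multiset (Row β)) :
    extensions (D + E) = extensions D + extensions E :=
  Multiset.map_add _ _ _

/-- The extension of the row of `v` is the key of the next longer suffix, so both sides list the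
words `v z` for all suffixes `v` of `u`. -/
theorem extensions_innerRows (u : List β) (z : Inf β) :
    z ::ₘ extensions (innerRows u z) = iapp u z ::ₘ keys (innerRows u z) := by
  induction u with
  | nil => rfl
  | cons c u ih =>
    rw [innerRows_cons, extensions_cons, Multiset.cons_swap, ih, keys_cons, iapp_cons]

variable [OrderBot β]

/-- The rows of the conjugates of a word. -/
noncomputable def conjRows (u : List β) : Multiset (Row β) := innerRows u (omega u)

/-- The rows of the conjugates of several words. -/
noncomputable def factorRows (fs : List (List β)) : Multiset (Row β) := (fs.map conjRows).sum

@[simp] theorem factorRows_nil : factorRows ([] : List (List β)) = 0 := rfl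

theorem factorRows_append (fs gs : List (List β)) :
    factorRows (fs ++ gs) = factorRows fs + factorRows gs := by
  simp [factorRows]

@[simp] theorem factorRows_singleton (f : List β) : factorRows [f] = conjRows f := by
  simp [factorRows]

theorem mem_factorRows {fs : List (List β)} {ρ : Row β} :
    ρ ∈ factorRows fs ↔ ∃ f ∈ fs, ρ ∈ conjRows f := by
  induction fs with
  | nil => simp
  | cons f fs ih =>
    rw [← List.singleton_append, factorRows_append, Multiset.mem_add, ih]
    simp

theorem card_factorRows (fs : List (List β)) : (factorRows fs).card = fs.flatten.length := by
  induction fs with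
  | nil => rfl
  | cons f fs ih =>
    rw [← List.singleton_append, factorRows_append, Multiset.card_add, ih]
    simp [conjRows, card_innerRows]

/-- For `z = omega u` the chain of suffixes closes to a cycle, since `u z = z`. -/
theorem extensions_conjRows {u : List β} (hu : u ≠ []) :
    extensions (conjRows u) = keys (conjRows u) := by
  have := extensions_innerRows u (omega u)
  rw [iapp_omega hu] at this
  exact Multiset.cons_inj_right _ |>.1 this

theorem extensions_factorRows {fs : List (List β)} (h : ∀ f ∈ fs, f ≠ []) :
    extensions (factorRows fs) = keys (factorRows fs) := by
  induction fs with
  | nil => rfl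
  | cons f fs ih =>
    rw [← List.singleton_append, factorRows_append, extensions_add, keys_add,
      ih fun g hg => h g (by simp [hg]), factorRows_singleton, extensions_conjRows (h f (by simp))]

/-- The last character of a conjugate reappears in its key at the end of every period. -/
theorem mem_conjRows {u : List β} (hu : u ≠ []) {ρ : Row β} (h : ρ ∈ conjRows u) :
    ∃ i, (ofLex ρ).1 = idrop i (omega u) ∧
      ∀ m, 0 < m → (ofLex ρ).1 (m * u.length - 1) = (ofLex ρ).2 := by
  obtain ⟨t, c, v, he, rfl⟩ := mem_innerRows h
  have hk : iapp v (omega u) = idrop (t.length + 1) (omega u) := by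
    conv_rhs => rw [← iapp_omega hu]
    have := idrop_iapp (t ++ [c]) (iapp v (omega u))
    rw [← iapp_append, List.append_assoc, List.singleton_append, ← he, List.length_append] at this
    exact this.symm
  refine ⟨t.length + 1, hk, fun m hm => ?_⟩
  change iapp v (omega u) _ = c
  rw [hk]
  change omega u (t.length + 1 + (m * u.length - 1)) = c
  have h0 : 0 < m * u.length := Nat.mul_pos hm (List.length_pos_iff.2 hu)
  have h1 : t.length + 1 + (m * u.length - 1) = t.length + m * u.length := by omega
  have h2 : t.length < u.length := by rw [he]; simp
  have := omega_apply' hu (t.length + m * u.length)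
  rw [Nat.add_mul_mod_self_right, Nat.mod_eq_of_lt h2] at this
  rw [h1]
  have h3 : u[t.length]? = some c := by rw [he]; simp
  rw [h3] at this
  exact (Option.some.inj this).symm

theorem consistent_factorRows {fs : List (List β)} (h : ∀ f ∈ fs, f ≠ []) :
    Consistent (factorRows fs) := by
  intro ρ hρ ρ' hρ' he
  obtain ⟨f, hf, hρ⟩ := mem_factorRows.1 hρ
  obtain ⟨g, hg, hρ'⟩ := mem_factorRows.1 hρ'
  obtain ⟨-, -, h1⟩ := mem_conjRows (h f hf) hρ
  obtain ⟨-, -, h2⟩ := mem_conjRows (h g hg) hρ'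
  -- Both characters are found in the common key at position `|f| |g| - 1`, where a period of either
  -- word ends.
  rw [← h1 g.length (List.length_pos_iff.2 (h g hg)),
    ← h2 f.length (List.length_pos_iff.2 (h f hf)), he, Nat.mul_comm]

theorem omega_le_idrop_of_mem_factorRows {fs : List (List β)} {F : List β} (hF : IsLyndon F)
    (h : ∀ f ∈ fs, IsLyndon f ∧ F ≤ f) {ρ : Row β} (hρ : ρ ∈ factorRows fs) (n : ℕ) :
    omega F ≤ idrop n (ofLex ρ).1 := by
  obtain ⟨f, hf, hρ⟩ := mem_factorRows.1 hρ
  obtain ⟨i, h1, -⟩ := mem_conjRows (h f hf).1.1 hρ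
  rw [h1, idrop_idrop]
  exact (hF.omega_le_omega (h f hf).1 (h f hf).2).trans ((h f hf).1.omega_le_idrop _)

theorem ne_bot_of_mem_factorRows {fs : List (List β)} (h : ∀ f ∈ fs, f ≠ [] ∧ ⊥ ∉ f)
    {ρ : Row β} (hρ : ρ ∈ factorRows fs) (n : ℕ) : (ofLex ρ).1 n ≠ ⊥ := by
  obtain ⟨f, hf, hρ⟩ := mem_factorRows.1 hρ
  obtain ⟨i, h1, -⟩ := mem_conjRows (h f hf).1 hρ
  intro h2
  have h3 := omega_apply' (h f hf).1 (i + n)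
  have h4 : omega f (i + n) = ⊥ := by
    rw [← h2, h1]; rfl
  rw [h4] at h3
  exact (h f hf).2 (List.mem_of_getElem? h3)

/-! ### Replacing the delimiter by an infinite word -/

/-- The comparison is either decided within `s`, or it leaves `z` against a tail of `y`. -/
theorem le_of_iapp_bots_le {s : List β} {y z : Inf β} (hy : ∀ n, z ≤ idrop n y)
    (h : iapp s bots ≤ y) : iapp s z ≤ y := by
  induction s generalizing y with
  | nil => simpa [idrop_zero] using hy 0
  | cons a s ih =>
    rw [← icons_idrop y, iapp_cons, icons_le] at h ⊢
    rcases h with h | ⟨h, h'⟩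
    · exact Or.inl h
    · exact Or.inr ⟨h, ih (fun n => by rw [idrop_idrop]; exact hy _) h'⟩

/-- If `t` ends first, `s` would have to continue with `⊥`, which is excluded. If `s` ends first,
what remains is `z ≤ iapp v z` for the rest `v` of `t`. -/
theorem iapp_le_iapp_of_bots {s t : List β} {z : Inf β} (hs : ⊥ ∉ s)
    (ht : ∀ v, v <:+ t → z ≤ iapp v z) (h : iapp s bots ≤ iapp t bots) :
    iapp s z ≤ iapp t z := by
  induction s generalizing t with
  | nil => exact ht t (List.suffix_refl t)
  | cons a s ih =>
    have ha : a ≠ ⊥ := fun e => hs (by simp [e])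
    cases t with
    | nil =>
      rw [iapp_nil, ← icons_bots, iapp_cons, icons_le] at h
      rcases h with h | h
      · exact absurd h not_lt_bot
      · exact absurd h.1 ha
    | cons b t =>
      rw [iapp_cons, iapp_cons, icons_le] at h ⊢
      rcases h with h | ⟨h, h'⟩
      · exact Or.inl h
      · exact Or.inr ⟨h, ih (fun e => hs (by simp [e]))
          (fun v hv => ht v (hv.trans (List.suffix_cons _ _))) h'⟩

/-- Instead of being continued by an infinite word that is smaller than everything else, the rows
can be cut off. -/
theorem bwtOf_innerRows_bots (E : Multiset (Row β)) (u : List β) (z : Inf β)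
    (hE : ∀ ρ ∈ E, ∀ n, z ≤ idrop n (ofLex ρ).1) (hu : ⊥ ∉ u.tail)
    (hz : ∀ v, v <:+ u.tail → z ≤ iapp v z) (hc : Consistent (E + innerRows u z)) :
    bwtOf (E + innerRows u z) = bwtOf (E + innerRows u bots) := by
  -- A common index set for the rows with `z` and with `bots`, as `bwtOf_congr` requires.
  have key : ∀ z : Inf β, E + innerRows u z =
      (E.map Sum.inl + ((inner u : List (List β × β)) : Multiset (List β × β)).map Sum.inr :
        Multiset (Row β ⊕ (List β × β))).map fun i =>
        row (i.elim (fun ρ => (ofLex ρ).1) fun p => iapp p.1 z)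
          (i.elim (fun ρ => (ofLex ρ).2) fun p => p.2) := by
    intro z
    rw [Multiset.map_add, Multiset.map_map, Multiset.map_map, Multiset.map_coe]
    congr 1
    exact (Multiset.map_id' E).symm
  have htail : ∀ p ∈ inner u, p.1 <:+ u.tail := by
    intro p hp
    obtain ⟨t, rfl⟩ := mem_inner hp
    cases t with
    | nil => exact List.suffix_refl _
    | cons a t => exact ⟨t ++ [p.2], by simp⟩
  rw [key z] at hc ⊢
  rw [key bots]
  refine (bwtOf_congr _ _ _ _ ?_ hc).symm
  intro i hi j hj hij
  rcases i with ρ | p <;> rcases j with ρ' | q <;>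
    simp only [Multiset.mem_add, Multiset.mem_map, Sum.inl.injEq, Sum.inr.injEq, reduceCtorEq,
      and_false, exists_false, or_false, false_or, exists_eq_right, Multiset.mem_coe] at hi hj <;>
    simp only [Sum.elim_inl, Sum.elim_inr] at hij ⊢
  · exact hij
  · exact hij.trans (iapp_le.2 (bots_le z))
  · exact le_of_iapp_bots_le (hE _ hj) hij
  · exact iapp_le_iapp_of_bots (fun h => hu ((htail p hi).subset h))
      (fun v hv => hz v (hv.trans (htail q hj))) hij

theorem IsLyndon.omega_le_iapp {F : List β} (hF : IsLyndon F) {v : List β} (hv : v <:+ F) :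
    omega F ≤ iapp v (omega F) := by
  obtain ⟨t, rfl⟩ := hv
  have := hF.omega_le_idrop t.length
  conv_rhs at this => rw [← iapp_omega hF.1, iapp_append, idrop_iapp]
  exact this

theorem IsLyndon.omega_lt_iapp {F : List β} (hF : IsLyndon F) {t v : List β} (he : F = t ++ v)
    (ht : t ≠ []) (hv : v ≠ []) : omega F < iapp v (omega F) := by
  have h1 := List.length_pos_iff.2 ht
  have h2 := List.length_pos_iff.2 hv
  have := hF.omega_lt_rotate (i := t.length) h1 (by rw [he, List.length_append]; omega)
  rwa [omega_rotate_eq_iapp hF.1 (by rw [he, List.length_append]; omega), he,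
    List.drop_left, ← he] at this

/-- Only the tail of `F` must avoid `⊥`, so this applies to a last Lyndon factor of a text and also
to `F = $u`. -/
theorem bwtOf_add_conjRows {fs : List (List β)} {F : List β} (hF : IsLyndon F)
    (h : ∀ f ∈ fs, IsLyndon f ∧ F ≤ f) (hb : ⊥ ∉ F.tail) :
    bwtOf (factorRows fs + conjRows F) = bwtOf (factorRows fs + innerRows F bots) := by
  refine bwtOf_innerRows_bots _ _ _
    (fun ρ hρ n => omega_le_idrop_of_mem_factorRows hF h hρ n) hb
    (fun v hv => hF.omega_le_iapp (hv.trans (List.tail_suffix F))) ?_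
  have := consistent_factorRows (fs := fs ++ [F]) (by
    intro f hf
    rcases List.mem_append.1 hf with hf | hf
    · exact (h f hf).1.1
    · rw [List.mem_singleton.1 hf]; exact hF.1)
  rwa [factorRows_append, factorRows_singleton] at this

end factors

/-! ### The bijective transform in terms of rows -/

section bbwt

variable {α β : Type*} [LinearOrder α] [LinearOrder β] [OrderBot β]

theorem IsLyndon.map {φ : α → β} (hφ : StrictMono φ) {u : List α} (hu : IsLyndon u) :
    IsLyndon (u.map φ) := by
  refine ⟨by simpa using hu.1, fun i h0 hi => ?_⟩
  rw [← List.map_rotate]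
  exact List.map_lt (fun _ _ h => hφ h) (hu.2 i h0 (by simpa using hi))

theorem map_le_map {φ : α → β} (hφ : StrictMono φ) {u v : List α} (h : u ≤ v) :
    u.map φ ≤ v.map φ := by
  rcases h.eq_or_lt with rfl | h
  · exact le_rfl
  · exact (List.map_lt (fun _ _ h => hφ h) h).le

theorem omegaLt_map {φ : α → β} (hφ : StrictMono φ) {u v : List α} :
    OmegaLt (u.map φ) (v.map φ) ↔ OmegaLt u v := by
  simp only [OmegaLt, List.length_map, List.getElem?_map]
  constructor
  · rintro ⟨k, a, b, h1, h2, h3, h4⟩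
    obtain ⟨a, h2', rfl⟩ := Option.map_eq_some_iff.1 h2
    obtain ⟨b, h3', rfl⟩ := Option.map_eq_some_iff.1 h3
    exact ⟨k, a, b, fun j hj => Option.map_injective hφ.injective (h1 j hj), h2', h3',
      hφ.lt_iff_lt.1 h4⟩
  · rintro ⟨k, a, b, h1, h2, h3, h4⟩
    exact ⟨k, φ a, φ b, fun j hj => by rw [h1 j hj], by simp [h2], by simp [h3], hφ h4⟩

/-- The row of a conjugate. -/
noncomputable def wordRow (w : List β) : Row β := row (omega w) (w.getLast?.getD ⊥)

theorem inner_eq_map (u : List β) :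
    inner u = (List.range u.length).map fun j => (u.drop (j + 1), u.getD j ⊥) := by
  induction u with
  | nil => rfl
  | cons c u ih =>
    rw [inner, ih, List.length_cons, List.range_succ_eq_map, List.map_cons, List.map_map]
    simp

theorem conjRows_eq_map {u : List β} (hu : u ≠ []) :
    conjRows u = (conjugates u : Multiset (List β)).map wordRow := by
  set g : ℕ → Row β := fun j => wordRow (u.rotate j) with hg
  have h1 : conjRows u = ((List.range u.length).map fun j => g (j + 1) : List (Row β)) := by
    rw [conjRows, innerRows, inner_eq_map, List.map_map]
    congr 1
    refine List.map_congr_left fun j hj => ?_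
    have hj := List.mem_range.1 hj
    simp only [Function.comp, hg, wordRow]
    rw [omega_rotate_eq_iapp hu hj, List.rotate_eq_drop_append_take hj,
      List.take_succ_eq_append_getElem hj, ← List.append_assoc, List.getLast?_concat,
      List.getD_eq_getElem _ _ hj]
    rfl
  -- The row with last character `u[j]` is that of the rotation by `j + 1`. The shift of the indices
  -- is harmless because rotation by `u.length` is rotation by `0`.
  have h2 : ((List.range u.length).map fun j => g (j + 1)).Perm ((List.range u.length).map g) := by
    have h3 : (List.range (u.length + 1)).map g =
        g 0 :: (List.range u.length).map fun j => g (j + 1) := by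
      rw [List.range_succ_eq_map, List.map_cons, List.map_map]; rfl
    have h4 : (List.range (u.length + 1)).map g = (List.range u.length).map g ++ [g 0] := by
      rw [List.range_succ, List.map_append, List.map_singleton]
      simp [hg]
    have h5 := (h3.symm.trans h4) ▸ (List.perm_append_singleton (g 0) ((List.range u.length).map g))
    exact (List.perm_cons _).1 h5
  rw [h1, Multiset.coe_eq_coe.2 h2, conjugates, Multiset.map_coe, List.map_map]
  rfl

theorem factorRows_eq_map {fs : List (List β)} (h : ∀ f ∈ fs, f ≠ []) :
    factorRows fs = (fs.flatMap conjugates : Multiset (List β)).map wordRow := by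
  induction fs with
  | nil => rfl
  | cons f fs ih =>
    rw [← List.singleton_append, factorRows_append, ih fun g hg => h g (by simp [hg]),
      factorRows_singleton, conjRows_eq_map (h f (by simp)), List.flatMap_append,
      ← Multiset.coe_add, Multiset.map_add]
    simp

/-- Rows need a least character, which `Fin σ` need not have or which may occur in the text. The
embedding `φ` into a larger alphabet is used with `WithBot (Fin σ)` for the algorithm on words and
with `ℕ` for the memory cells. -/
theorem map_bbwt {φ : α → β} (hφ : StrictMono φ) (T : List α) :
    (bbwt T).map φ = bwtOf (factorRows ((lyndonFactors T).map (List.map φ))) := by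
  classical
  have hne : ∀ w ∈ (lyndonFactors T).flatMap conjugates, w ≠ [] := by
    intro w hw
    obtain ⟨f, hf, hw⟩ := List.mem_flatMap.1 hw
    obtain ⟨i, -, rfl⟩ := List.mem_map.1 hw
    simpa using ((lyndonFactors_spec T).2.1 f hf).1
  set r : Row β → Row β → Bool := fun ρ ρ' => decide ((ofLex ρ).1 ≤ (ofLex ρ').1) with hr
  have hs := List.map_mergeSort (l := (lyndonFactors T).flatMap conjugates)
    (r := fun u v => decide (¬ OmegaLt v u)) (s := r) (f := fun w => wordRow (w.map φ)) (by
      intro a ha b hb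
      have h := omegaLt_iff (u := b.map φ) (v := a.map φ) (by simpa using hne b hb)
        (by simpa using hne a ha)
      rw [omegaLt_map hφ] at h
      simp only [hr, decide_eq_decide, h, not_lt]
      rfl)
  have hms : (((lyndonFactors T).flatMap conjugates).map (fun w => wordRow (w.map φ)) :
      Multiset (Row β)) = factorRows ((lyndonFactors T).map (List.map φ)) := by
    rw [factorRows_eq_map, Multiset.map_coe, List.flatMap_map]
    · congr 1
      rw [List.map_flatMap, List.map_flatMap]
      congr 1
      funext f
      simp only [conjugates, List.map_map, List.length_map]
      congr 1
      funext i
      simp [List.map_rotate]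
    · intro f hf
      obtain ⟨g, hg, rfl⟩ := List.mem_map.1 hf
      simpa using ((lyndonFactors_spec T).2.1 g hg).1
  have hperm := List.mergeSort_perm
    (((lyndonFactors T).flatMap conjugates).map (fun w => wordRow (w.map φ))) r
  rw [← hms, ← Multiset.coe_eq_coe.2 hperm, bwtOf_coe_of_consistent, ← hs, List.map_map, bbwt]
  · have : ∀ l : List (List α), (∀ w ∈ l, w ≠ []) →
        (l.filterMap List.getLast?).map φ =
          l.map ((fun ρ => (ofLex ρ).2) ∘ fun w => wordRow (w.map φ)) := by
      intro l hl
      induction l with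
      | nil => rfl
      | cons w l ih =>
        have hw := hl w (by simp)
        rw [List.filterMap_cons_some (List.getLast?_eq_some_getLast hw), List.map_cons,
          ih fun w hw => hl w (by simp [hw]), List.map_cons]
        simp [wordRow, row, List.getLast?_eq_some_getLast hw]
    exact this _ fun w hw => hne w ((List.mergeSort_perm _ _).subset hw)
  · have := List.pairwise_mergeSort (le := r)
      (fun a b c h1 h2 => by
        simp only [hr, decide_eq_true_eq] at *
        exact h1.trans h2)
      (fun a b => by
        simp only [hr, Bool.or_eq_true, decide_eq_true_eq]
        exact le_total _ _)
      (((lyndonFactors T).flatMap conjugates).map (fun w => wordRow (w.map φ)))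
    exact this.imp fun h => by simpa [hr] using h
  · rw [Multiset.coe_eq_coe.2 hperm, hms]
    refine consistent_factorRows fun f hf => ?_
    obtain ⟨g, hg, rfl⟩ := List.mem_map.1 hf
    simpa using ((lyndonFactors_spec T).2.1 g hg).1

end bbwt

/-! ### Removing and prepending a single character -/

theorem countP_lt_cons {ι : Type*} [LinearOrder ι] {x a : ι} (s : Multiset ι) (h : x < a) :
    (x ::ₘ s).countP (· < a) = s.countP (· < a) + 1 :=
  Multiset.countP_cons_of_pos (p := (· < a)) s h

theorem countP_lt_cons_of_le {ι : Type*} [LinearOrder ι] {x a : ι} (s : Multiset ι) (h : a ≤ x) :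
    (x ::ₘ s).countP (· < a) = s.countP (· < a) :=
  Multiset.countP_cons_of_neg (p := (· < a)) s (not_lt.2 h)

section steps

variable {β : Type*} [LinearOrder β]

/-- The rank of the infinite word `y` among the rows `E` and the rows `v y`, for the proper
suffixes `v` of `u`. -/
noncomputable def keyRank (E : Multiset (Row β)) (u : List β) (y : Inf β) : ℕ :=
  (keys (E + innerRows u y)).countP (· < y)

/-- The row with last character `c` has the key `y` itself and is not counted, so it may be deleted.
-/
theorem keyRank_concat (E : Multiset (Row β)) (u : List β) (c : β) (y : Inf β) :
    keyRank E (u ++ [c]) y = (keys (E + innerRows u (icons c y))).countP (· < y) := by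
  rw [keyRank, innerRows_append]
  simp only [innerRows_cons, innerRows_nil, iapp_cons, iapp_nil, keys_add, keys_cons,
    Multiset.countP_add, keys_zero]
  rw [countP_lt_cons_of_le _ le_rfl]
  simp

theorem add_innerRows_concat (E : Multiset (Row β)) (u : List β) (c : β) (y : Inf β) :
    E + innerRows (u ++ [c]) y = row y c ::ₘ (E + innerRows u (icons c y)) := by
  rw [innerRows_append, ← Multiset.add_cons, ← Multiset.singleton_add, add_comm (innerRows u _)]
  rfl

theorem add_innerRows_cons (E : Multiset (Row β)) (u : List β) (c : β) (y : Inf β) :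
    E + innerRows (c :: u) y = row (iapp u y) c ::ₘ (E + innerRows u y) := by
  rw [innerRows_cons, Multiset.add_cons]

theorem extensions_add_innerRows {E : Multiset (Row β)} (hE : extensions E = keys E) (u : List β)
    (y : Inf β) : y ::ₘ extensions (E + innerRows u y) = iapp u y ::ₘ keys (E + innerRows u y) := by
  rw [extensions_add, keys_add, hE, ← Multiset.add_cons, extensions_innerRows, Multiset.add_cons]

/-- Removing the row that is extended by its last character `c`. -/
theorem bwtOf_innerRows_concat {E : Multiset (Row β)} {u : List β} {c : β} {y : Inf β}
    (hc : Consistent (E + innerRows (u ++ [c]) y)) :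
    bwtOf (E + innerRows (u ++ [c]) y) =
      (bwtOf (E + innerRows u (icons c y))).insertIdx (keyRank E (u ++ [c]) y) c ∧
    keyRank E (u ++ [c]) y ≤ (bwtOf (E + innerRows u (icons c y))).length := by
  rw [add_innerRows_concat] at hc
  have h := rowRank_eq_of_consistent hc
  rw [keyRank_concat, add_innerRows_concat, bwtOf_cons]
  unfold keys
  rw [← h]
  exact ⟨rfl, rowRank_le _ _⟩

theorem countLt_add_count_innerRows_concat [DecidableEq β] {E : Multiset (Row β)} {u : List β}
    {c : β} {y : Inf β} (hE : extensions E = keys E)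
    (hc : Consistent (E + innerRows (u ++ [c]) y)) :
    countLt (bwtOf (E + innerRows (u ++ [c]) y)) c +
      ((bwtOf (E + innerRows (u ++ [c]) y)).take (keyRank E (u ++ [c]) y)).count c =
    keyRank E u (icons c y) + if iapp (u ++ [c]) y < icons c y then 1 else 0 := by
  have h := rowRank_eq_of_consistent (add_innerRows_concat E u c y ▸ hc)
  have h1 : keyRank E (u ++ [c]) y = rowRank (E + innerRows (u ++ [c]) y) (row y c) := by
    rw [keyRank_concat]
    unfold keys
    rw [← h, add_innerRows_concat, rowRank, rowRank, countP_lt_cons_of_le _ le_rfl]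
  -- Cancelling `y` shows that the extensions are the keys without the row of `y`, and one
  -- additional word `u c y`; the latter accounts for the `if`.
  have h2 := extensions_add_innerRows hE (u ++ [c]) y
  conv_rhs at h2 => rw [add_innerRows_concat, keys_cons, Multiset.cons_swap]
  rw [Multiset.cons_inj_right] at h2
  rw [h1, countLt_add_count]
  change (extensions _).countP _ = _
  rw [h2, Multiset.countP_cons]
  rfl

variable [OrderBot β]

theorem iapp_bots_ne {u v : List β} (hu : ⊥ ∉ u) (h : v.length < u.length) :
    (iapp v bots : Inf β) ≠ iapp u bots := by
  intro he
  have h1 : (iapp v bots : Inf β) v.length = ⊥ := by rw [iapp_apply_ge _ le_rfl]; rfl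
  rw [he, iapp_apply_lt _ h] at h1
  exact hu (h1 ▸ List.getElem_mem h)

/-- The position of the first `⊥` tells the keys apart: there is none in the keys of `E`, and it
comes earlier in those of proper suffixes of `u`. -/
theorem key_ne_iapp_bots {E : Multiset (Row β)} {u : List β} (hu : ⊥ ∉ u)
    (hE : ∀ ρ ∈ E, ∀ n, (ofLex ρ).1 n ≠ ⊥) {ρ : Row β} (hρ : ρ ∈ E + innerRows u bots) :
    (ofLex ρ).1 ≠ iapp u bots := by
  rcases Multiset.mem_add.1 hρ with hρ | hρ
  · intro he
    refine hE ρ hρ u.length ?_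
    rw [he, iapp_apply_ge _ le_rfl]; rfl
  · obtain ⟨t, c, v, rfl, rfl⟩ := mem_innerRows hρ
    exact iapp_bots_ne hu (by simp; omega)

/-- The transform of the words with rows `E` and of `$u`. -/
noncomputable def delimText (E : Multiset (Row β)) (u : List β) : List β :=
  bwtOf (E + innerRows (⊥ :: u) bots)

/-- The position of `$` in this transform. -/
noncomputable def delimPos (E : Multiset (Row β)) (u : List β) : ℕ :=
  (keys (E + innerRows u bots)).countP (· < iapp u bots)

theorem rowRank_delim (E : Multiset (Row β)) (u : List β) :
    rowRank (E + innerRows u bots) (row (iapp u bots) ⊥) = delimPos E u :=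
  rowRank_eq fun _ _ _ => bot_le

theorem delimText_eq (E : Multiset (Row β)) (u : List β) :
    delimText E u = (bwtOf (E + innerRows u bots)).insertIdx (delimPos E u) ⊥ := by
  rw [delimText, add_innerRows_cons, bwtOf_cons, rowRank_delim]

theorem delimPos_le (E : Multiset (Row β)) (u : List β) :
    delimPos E u ≤ (bwtOf (E + innerRows u bots)).length := by
  rw [← rowRank_delim]; exact rowRank_le _ _

theorem delimText_getElem (E : Multiset (Row β)) (u : List β) :
    (delimText E u)[delimPos E u]? = some ⊥ := by
  rw [delimText_eq, List.getElem?_insertIdx_self, if_pos (delimPos_le E u)]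

theorem delimPos_nil (E : Multiset (Row β)) : delimPos E [] = 0 := by
  rw [delimPos, Multiset.countP_eq_zero]
  exact fun x _ => not_lt.2 (bots_le x)

theorem delimText_nil (E : Multiset (Row β)) : delimText E [] = ⊥ :: bwtOf E := by
  rw [delimText_eq, delimPos_nil]; simp

theorem bwtOf_innerRows_bots_cons {E : Multiset (Row β)} {u : List β} {c : β}
    (hE : ∀ ρ ∈ E, ∀ n, (ofLex ρ).1 n ≠ ⊥) (hu : ⊥ ∉ u) :
    bwtOf (E + innerRows (c :: u) bots) = (delimText E u).set (delimPos E u) c := by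
  have h : rowRank (E + innerRows u bots) (row (iapp u bots) c) = delimPos E u :=
    rowRank_eq fun ρ hρ he => absurd he (key_ne_iapp_bots hu hE hρ)
  rw [delimText_eq, add_innerRows_cons, bwtOf_cons, h]
  apply List.ext_getElem?
  intro i
  have := delimPos_le E u
  rw [List.getElem?_set, List.getElem?_insertIdx, List.getElem?_insertIdx,
    List.length_insertIdx]
  split_ifs <;> first | rfl | omega

/-- Prepending a character to the word after `$`. -/
theorem delimText_cons {E : Multiset (Row β)} {u : List β} {c : β}
    (hE : ∀ ρ ∈ E, ∀ n, (ofLex ρ).1 n ≠ ⊥) (hu : ⊥ ∉ u) :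
    delimText E (c :: u) =
      ((delimText E u).set (delimPos E u) c).insertIdx (delimPos E (c :: u)) ⊥ := by
  rw [delimText_eq E (c :: u), bwtOf_innerRows_bots_cons hE hu]

theorem delimPos_cons [DecidableEq β] {E : Multiset (Row β)} {u : List β} {c : β}
    (hE : extensions E = keys E)
    (hE' : ∀ ρ ∈ E, ∀ n, (ofLex ρ).1 n ≠ ⊥) (hu : ⊥ ∉ u) (hc : c ≠ ⊥) :
    delimPos E (c :: u) =
      countLt (delimText E u) c + ((delimText E u).take (delimPos E u)).count c := by
  have hb : ⊥ < c := bot_lt_iff_ne_bot.2 hc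
  have h1 : ((delimText E u).take (delimPos E u)).count c =
      ((delimText E u).take (delimPos E u + 1)).count c := by
    rw [List.take_add_one, delimText_getElem, List.count_append]
    simp [hc.symm]
  -- A row with last character `c` and the key of the row of `$` sorts directly behind the latter.
  -- The entry passed over is `⊥`, so the count of `c` is unaffected.
  have h2 : delimPos E u + 1 =
      rowRank (E + innerRows (⊥ :: u) bots) (row (iapp u bots) c) := by
    have h : rowRank (E + innerRows u bots) (row (iapp u bots) c) = delimPos E u :=
      rowRank_eq fun ρ hρ he => absurd he (key_ne_iapp_bots hu hE' hρ)
    rw [add_innerRows_cons, ← h, rowRank, rowRank,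
      countP_lt_cons _ (row_lt.2 (Or.inr ⟨rfl, hb⟩))]
  have h3 := extensions_add_innerRows hE u (bots : Inf β)
  have h4 : (bots : Inf β) < icons c (iapp u bots) := by
    rw [← icons_bots, icons_lt]; exact Or.inl hb
  -- Besides the extensions of the rows without `$`, one side counts `bots`, the key of the empty
  -- suffix, and the other one the extension of the row of `$`. Each contributes one.
  rw [h1, h2, delimText, countLt_add_count]
  change _ = (extensions _).countP _
  rw [add_innerRows_cons, extensions_cons,
    countP_lt_cons _ (icons_lt.2 (Or.inl hb)), delimPos, add_innerRows_cons,
    keys_cons, ← h3, iapp_cons, countP_lt_cons _ h4]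

theorem delimPos_cons_pos {E : Multiset (Row β)} {u : List β} {c : β}
    (hE : extensions E = keys E)
    (hE' : ∀ ρ ∈ E, ∀ n, (ofLex ρ).1 n ≠ ⊥) (hu : ⊥ ∉ u) (hc : c ≠ ⊥) : 0 < delimPos E (c :: u) := by
  classical
  rw [delimPos_cons hE hE' hu hc]
  refine Nat.add_pos_left (List.countP_pos_iff.2 ⟨⊥, List.mem_of_getElem? (delimText_getElem E u),
    ?_⟩) _
  simpa using bot_lt_iff_ne_bot.2 hc

/-- Only the empty suffix gives a key below `F $ $ ⋯`: non-empty proper suffixes of a Lyndon word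
are larger than it, and the keys of the other factors are at least `omega F`. -/
theorem delimPos_of_isLyndon {fs : List (List β)} {F : List β} (hF : IsLyndon F)
    (h : ∀ f ∈ fs, IsLyndon f ∧ F ≤ f) (hb : ⊥ ∉ F) : delimPos (factorRows fs) F = 1 := by
  obtain ⟨u, c, rfl⟩ : ∃ u c, F = u ++ [c] :=
    ⟨F.dropLast, F.getLast hF.1, (List.dropLast_append_getLast hF.1).symm⟩
  rw [delimPos, add_innerRows_concat, keys_cons, Multiset.countP_cons_of_pos, keys_add,
    Multiset.countP_add, Multiset.countP_eq_zero.2, Multiset.countP_eq_zero.2]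
  · intro x hx
    obtain ⟨ρ, hρ, rfl⟩ := Multiset.mem_map.1 hx
    obtain ⟨t, d, v, rfl, rfl⟩ := mem_innerRows hρ
    have := (isLyndon_iff_suffix.1 hF).2 (t ++ [d]) (v ++ [c]) (by simp) (by simp) (by simp)
    have h2 := iapp_lt_iapp_of_not_prefix this (fun hp => by
      have := hp.length_le
      simp at this
      omega) bots bots
    rw [iapp_append v] at h2
    exact not_lt.2 h2.le
  · intro x hx
    obtain ⟨ρ, hρ, rfl⟩ := Multiset.mem_map.1 hx
    have := omega_le_idrop_of_mem_factorRows hF h hρ 0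
    rw [idrop_zero, ← iapp_omega hF.1] at this
    exact not_lt.2 ((iapp_le.2 (bots_le _)).trans this)
  · rw [← icons_bots, icons_bots]
    refine (iapp_bots_ne (v := []) hb (by simp)).lt_of_le (bots_le _)

end steps

/-! ### The forward step -/

section forward

theorem insertIdx_append_of_le {ι : Type*} {l m : List ι} {k : ℕ} (h : k ≤ l.length) (a : ι) :
    (l ++ m).insertIdx k a = l.insertIdx k a ++ m := by
  induction l generalizing k with
  | nil =>
    have : k = 0 := by simpa using h
    subst this; simp
  | cons b l ih =>
    cases k with
    | zero => simp
    | succ k => simp [ih (k := k) (by simpa using h)]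

theorem insertIdx_append_add {ι : Type*} (l m : List ι) (k : ℕ) (a : ι) :
    (l ++ m).insertIdx (l.length + k) a = l ++ m.insertIdx k a := by
  induction l with
  | nil => simp
  | cons b l ih =>
    rw [List.length_cons, Nat.add_right_comm, List.cons_append, List.insertIdx_succ_cons, ih]
    simp

/-- In a sorted list the copies of `c` form a block directly behind the smaller characters. Applied
to `first L`, this makes `FL` the inverse of LF; `p` counts from 1. -/
theorem sorted_getElem {ι : Type*} [LinearOrder ι] {s : List ι} (hs : s.Pairwise (· ≤ ·)) {c : ι}
    {p : ℕ} (h1 : countLt s c < p) (h2 : p ≤ countLt s c + s.count c) :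
    s[p - 1]? = some c ∧ countLt s c + (s.take p).count c = p := by
  induction s generalizing p with
  | nil => simp [countLt] at h1 h2; omega
  | cons x s ih =>
    obtain ⟨hx, hs⟩ := List.pairwise_cons.1 hs
    obtain ⟨p, rfl⟩ : ∃ q, p = q + 1 := ⟨p - 1, by omega⟩
    have h0 : c ≤ x → countLt s c = 0 := by
      intro h
      rw [countLt, List.countP_eq_zero]
      intro a ha
      simpa using h.trans (hx a ha)
    have hc : countLt (x :: s) c = countLt s c + if x < c then 1 else 0 := by
      simp [countLt, List.countP_cons]
    rw [hc] at h1 h2 ⊢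
    rcases lt_trichotomy x c with h | h | h
    · rw [if_pos h] at h1 h2 ⊢
      rw [List.count_cons_of_ne h.ne] at h2
      obtain ⟨h3, h4⟩ := ih hs (p := p) (by omega) (by omega)
      obtain ⟨p, rfl⟩ : ∃ q, p = q + 1 := ⟨p - 1, by omega⟩
      rw [List.take_succ_cons, List.count_cons_of_ne h.ne]
      exact ⟨by simpa using h3, by omega⟩
    · subst h
      rw [if_neg (lt_irrefl _)] at h1 h2 ⊢
      have h0 := h0 le_rfl
      rw [List.count_cons_self] at h2
      rw [List.take_succ_cons, List.count_cons_self]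
      rcases Nat.eq_zero_or_pos p with rfl | hp
      · simp [h0]
      · obtain ⟨h3, h4⟩ := ih hs (p := p) (by omega) (by omega)
        obtain ⟨p, rfl⟩ : ∃ q, p = q + 1 := ⟨p - 1, by omega⟩
        exact ⟨by simpa using h3, by omega⟩
    · have h0 := h0 h.le
      rw [if_neg h.not_gt] at h1 h2
      have : (x :: s).count c = 0 := by
        rw [List.count_eq_zero, List.mem_cons]
        rintro (h' | h')
        · exact h.ne h'
        · exact absurd (hx c h') (not_le.2 h)
      omega

theorem select_rank {σ : ℕ} {L : DWord σ} {c : WithBot (Fin σ)} {i : ℕ}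
    (h : L[i]? = some c) : select L c (rank L c (i + 1)) = i + 1 := by
  have hi : i < L.length := (List.getElem?_eq_some_iff.1 h).1
  have : (List.range (L.length + 1)).find?
      (fun p => decide (rank L c p = rank L c (i + 1))) = some (i + 1) := by
    rw [List.find?_range_eq_some]
    refine ⟨by simp, List.mem_range.2 (by omega), fun j hj => ?_⟩
    have h1 : rank L c (i + 1) = rank L c i + 1 := by
      rw [rank, rank, List.take_add_one, h, List.count_append]
      simp
    have h2 : rank L c j ≤ rank L c i :=
      (List.take_sublist_take_left (by omega)).count_le c
    have h3 : rank L c j ≠ rank L c (i + 1) := by omega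
    simp [h3]
  rw [select, this]
  rfl

theorem FL_eq {σ : ℕ} {L : DWord σ} {c : WithBot (Fin σ)} {i p : ℕ} (h : L[i]? = some c)
    (hp : p = countLt L c + rank L c (i + 1)) : FL L p = i + 1 := by
  have hperm : (first L).Perm L := List.mergeSort_perm _ _
  have hs : (first L).Pairwise (· ≤ ·) := List.pairwise_mergeSort' _ _
  have h1 : countLt (first L) c = countLt L c := hperm.countP_eq _
  have h2 : (first L).count c = L.count c := hperm.count_eq _
  have h3 : 0 < rank L c (i + 1) := by
    rw [rank, List.count_pos_iff]
    exact List.mem_of_getElem? (i := i) (by rw [List.getElem?_take, if_pos (by omega), h])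
  have h4 : rank L c (i + 1) ≤ L.count c := (List.take_sublist _ _).count_le c
  obtain ⟨h5, h6⟩ := sorted_getElem hs (c := c) (p := p) (by omega) (by omega)
  have h7 : rank (first L) c p = rank L c (i + 1) := by
    unfold rank at *; omega
  simp only [FL, h5, h7]
  exact select_rank h

/-- The inversion step undoes the update in `delimText_cons`. Here `q` and `q'` count from 0, while
the state stores positions from 1. -/
theorem invStep_eq {σ : ℕ} {X : DWord σ} {q q' : ℕ} {c : WithBot (Fin σ)} (hc : c ≠ ⊥)
    (hq : X[q]? = some ⊥) (hq' : q' = countLt X c + (X.take q).count c) (hl : q' ≤ X.length)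
    (out : DWord σ) :
    invStep ⟨(X.set q c).insertIdx q' ⊥, q' + 1, out⟩ = ⟨X, q + 1, out ++ [c]⟩ := by
  obtain ⟨hql, hqe⟩ := List.getElem?_eq_some_iff.1 hq
  obtain ⟨A, B, rfl, rfl⟩ : ∃ A B, X = A ++ ⊥ :: B ∧ q = A.length :=
    ⟨X.take q, X.drop (q + 1), by
      rw [← hqe, List.getElem_cons_drop, List.take_append_drop], by simp; omega⟩
  have hbc : ¬ c < ⊥ := not_lt_bot
  set Y := ((A ++ ⊥ :: B).set A.length c).insertIdx q' ⊥ with hY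
  have hset : (A ++ ⊥ :: B).set A.length c = A ++ c :: B := by
    rw [List.set_append_right _ _ le_rfl]; simp
  rw [List.take_left] at hq'
  -- One `⊥` was overwritten by `c` and one was inserted, so the number of smaller characters is the
  -- same.
  have hcnt : countLt Y c = countLt (A ++ ⊥ :: B) c := by
    have hp := List.perm_insertIdx (⊥ : WithBot (Fin σ)) (A ++ c :: B) (i := q') (by simpa using hl)
    rw [hY, hset, countLt, hp.countP_eq, countLt]
    have := bot_lt_iff_ne_bot.2 hc
    simp [List.countP_append, this]
    omega
  -- The inserted `$` lies behind `c` or in front of it. Only in the second case is `c` displaced by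
  -- one, which the conditional in `invStep` corrects after the deletion.
  rcases Nat.lt_or_ge A.length q' with h | h
  · obtain ⟨j, rfl⟩ : ∃ j, q' = A.length + (j + 1) := ⟨q' - A.length - 1, by omega⟩
    have hY' : Y = A ++ c :: B.insertIdx j ⊥ := by
      rw [hY, hset, insertIdx_append_add, List.insertIdx_succ_cons]
    have hg : Y[A.length]? = some c := by rw [hY']; simp
    have hF : FL Y (A.length + (j + 1) + 1) = A.length + 1 := by
      refine FL_eq hg ?_
      have : Y.take (A.length + 1) = A ++ [c] := by
        rw [hY', List.take_append, List.take_of_length_le (by omega)]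
        simp
      rw [rank, this, hcnt, List.count_append, List.count_singleton_self]
      omega
    simp only [invStep, hF, Nat.add_sub_cancel, hg]
    rw [if_neg (by omega), hY', List.set_append_right _ _ le_rfl, Nat.sub_self, List.set_cons_zero,
      List.eraseIdx_append_of_length_le (by omega), Nat.add_sub_cancel_left,
      List.eraseIdx_cons_succ, List.eraseIdx_insertIdx_self]
    rfl
  · have hY' : Y = A.insertIdx q' ⊥ ++ c :: B := by
      rw [hY, hset, insertIdx_append_of_le h]
    have hl' : (A.insertIdx q' ⊥).length = A.length + 1 := List.length_insertIdx_of_le_length h _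
    have hg : Y[A.length + 1]? = some c := by
      rw [hY', List.getElem?_append_right (by omega), hl']; simp
    have hF : FL Y (q' + 1) = A.length + 1 + 1 := by
      refine FL_eq hg ?_
      have : Y.take (A.length + 1 + 1) = A.insertIdx q' ⊥ ++ [c] := by
        rw [hY', List.take_append, List.take_of_length_le (by omega), hl']
        simp
      have h2 : (A.insertIdx q' ⊥).count c = A.count c := by
        rw [(List.perm_insertIdx (⊥ : WithBot (Fin σ)) A h).count_eq,
          List.count_cons_of_ne hc.symm]
      rw [rank, this, hcnt, List.count_append, List.count_singleton_self, h2]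
      omega
    simp only [invStep, hF, Nat.add_sub_cancel, hg]
    rw [if_pos (by omega), hY', List.set_append_right _ _ (by omega), hl', Nat.sub_self,
      List.set_cons_zero, List.eraseIdx_append_of_lt_length (by omega),
      List.eraseIdx_insertIdx_self]
    rfl

end forward

/-! ### Correctness of the inversion algorithm -/

section inversion

theorem lyndonFactors_eq {α : Type*} [LinearOrder α] {fs : List (List α)} {T : List α}
    (h : IsLyndonFactorization fs T) : lyndonFactors T = fs :=
  lyndonFactorization_unique (lyndonFactors_spec T) h

theorem lyndonFactors_take {α : Type*} [LinearOrder α] (T : List α) (x : ℕ) :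
    lyndonFactors ((lyndonFactors T).take x).flatten = (lyndonFactors T).take x :=
  lyndonFactors_eq ⟨rfl, fun f hf => (lyndonFactors_spec T).2.1 f (List.mem_of_mem_take hf),
    (lyndonFactors_spec T).2.2.sublist (List.take_sublist _ _)⟩

theorem isLyndon_bot_cons {β : Type*} [LinearOrder β] [OrderBot β] {u : List β} (hu : ⊥ ∉ u) :
    IsLyndon (⊥ :: u) := by
  rw [isLyndon_iff_suffix]
  refine ⟨by simp, fun x y hx hy he => ?_⟩
  cases x with
  | nil => exact absurd rfl hx
  | cons a x =>
    cases y with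
    | nil => exact absurd rfl hy
    | cons b y =>
      refine List.cons_lt_cons_iff.2 (Or.inl (bot_lt_iff_ne_bot.2 fun hb => hu ?_))
      rw [List.cons_append, List.cons.injEq] at he
      rw [he.2, hb]
      simp

theorem bot_cons_le {β : Type*} [LinearOrder β] [OrderBot β] {u v : List β} (hv : v ≠ [])
    (hb : ⊥ ∉ v) : ⊥ :: u ≤ v := by
  cases v with
  | nil => exact absurd rfl hv
  | cons b v =>
    exact (List.cons_lt_cons_iff.2 (Or.inl (bot_lt_iff_ne_bot.2 fun h => hb (by simp [h])))).le

variable {α β : Type*} [LinearOrder α] [LinearOrder β] [OrderBot β]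

theorem lyndonFactors_delim {φ : α → β} (hφ : StrictMono φ) (hb : ∀ a, φ a ≠ ⊥) (T : List α)
    {u : List β} (hu : ⊥ ∉ u) :
    lyndonFactors (T.map φ ++ ⊥ :: u) = (lyndonFactors T).map (List.map φ) ++ [⊥ :: u] := by
  obtain ⟨h1, h2, h3⟩ := lyndonFactors_spec T
  refine lyndonFactors_eq ⟨?_, ?_, ?_⟩
  · rw [List.flatten_append, ← List.map_flatten, h1]; simp
  · intro f hf
    rcases List.mem_append.1 hf with hf | hf
    · obtain ⟨g, hg, rfl⟩ := List.mem_map.1 hf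
      exact (h2 g hg).map hφ
    · rw [List.mem_singleton.1 hf]; exact isLyndon_bot_cons hu
  · rw [List.pairwise_append]
    refine ⟨List.pairwise_map.2 (h3.imp fun h => map_le_map hφ h), by simp, ?_⟩
    intro f hf g hg
    obtain ⟨f', hf', rfl⟩ := List.mem_map.1 hf
    rw [List.mem_singleton.1 hg]
    exact bot_cons_le (by simpa using (h2 f' hf').1) (by simpa using fun a _ => hb a)

/-- The rows of the Lyndon factors of a word, over an alphabet with a delimiter. -/
noncomputable def textRows (φ : α → β) (fs : List (List α)) : Multiset (Row β) :=
  factorRows (fs.map (List.map φ))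

theorem textRows_isLyndon {φ : α → β} (hφ : StrictMono φ) {fs : List (List α)} {F : List α}
    (h : ∀ f ∈ fs, IsLyndon f ∧ F ≤ f) :
    ∀ f ∈ fs.map (List.map φ), IsLyndon f ∧ F.map φ ≤ f := by
  intro f hf
  obtain ⟨g, hg, rfl⟩ := List.mem_map.1 hf
  exact ⟨(h g hg).1.map hφ, map_le_map hφ (h g hg).2⟩

theorem extensions_textRows (φ : α → β) {fs : List (List α)} (h : ∀ f ∈ fs, f ≠ []) :
    extensions (textRows φ fs) = keys (textRows φ fs) := by
  refine extensions_factorRows fun f hf => ?_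
  obtain ⟨g, hg, rfl⟩ := List.mem_map.1 hf
  simpa using h g hg

theorem textRows_ne_bot {φ : α → β} (hb : ∀ a, φ a ≠ ⊥) {fs : List (List α)}
    (h : ∀ f ∈ fs, f ≠ []) : ∀ ρ ∈ textRows φ fs, ∀ n, (ofLex ρ).1 n ≠ ⊥ := by
  intro ρ hρ
  refine ne_bot_of_mem_factorRows (fun f hf => ?_) hρ
  obtain ⟨g, hg, rfl⟩ := List.mem_map.1 hf
  exact ⟨by simpa using h g hg, by simpa using fun a _ => hb a⟩

/-- The transform of `T $ u`. -/
theorem bbwt_delim {φ : α → β} (hφ : StrictMono φ) (hb : ∀ a, φ a ≠ ⊥) (T : List α)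
    {u : List β} (hu : ⊥ ∉ u) :
    bbwt (T.map φ ++ ⊥ :: u) = delimText (textRows φ (lyndonFactors T)) u := by
  have h := map_bbwt (φ := (id : β → β)) strictMono_id (T.map φ ++ ⊥ :: u)
  rw [List.map_id, lyndonFactors_delim hφ hb T hu] at h
  have hid : ∀ l : List (List β), l.map (List.map id) = l := fun l => by simp
  rw [h, hid, factorRows_append, factorRows_singleton, bwtOf_add_conjRows (isLyndon_bot_cons hu)
    (fun f hf => ?_) hu]
  · rfl
  · obtain ⟨g, hg, rfl⟩ := List.mem_map.1 hf
    have := (lyndonFactors_spec T).2.1 g hg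
    exact ⟨this.map hφ, bot_cons_le (by simpa using this.1) (by simpa using fun a _ => hb a)⟩

theorem map_bbwt_flatten {φ : α → β} (hφ : StrictMono φ) (T : List α) (x : ℕ) :
    (bbwt ((lyndonFactors T).take x).flatten).map φ = bwtOf (textRows φ ((lyndonFactors T).take x)) := by
  rw [map_bbwt hφ, lyndonFactors_take]
  rfl

theorem lyndonFactors_take_le (T : List α) {x : ℕ} (hx : x < (lyndonFactors T).length) :
    ∀ f ∈ (lyndonFactors T).take x, IsLyndon f ∧ (lyndonFactors T)[x] ≤ f := by
  obtain ⟨-, h2, h3⟩ := lyndonFactors_spec T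
  intro f hf
  refine ⟨h2 f (List.mem_of_mem_take hf), ?_⟩
  obtain ⟨i, hi, rfl⟩ := List.mem_iff_getElem.1 hf
  rw [List.getElem_take]
  exact List.pairwise_iff_getElem.1 h3 _ _ _ _ (by simp at hi; omega)

theorem coe_strictMono (σ : ℕ) : StrictMono (WithBot.some : Fin σ → WithBot (Fin σ)) :=
  WithBot.coe_strictMono

theorem lift_eq {σ : ℕ} (u : List (Fin σ)) :
    lift u = u.map (WithBot.some : Fin σ → WithBot (Fin σ)) := by
  rw [List.map_eq_flatMap]
  simp [lift]

theorem length_lift {σ : ℕ} (u : List (Fin σ)) : (lift u).length = u.length := by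
  rw [lift_eq, List.length_map]

theorem bot_notMem_lift {σ : ℕ} (u : List (Fin σ)) : ⊥ ∉ lift u := by simp [lift_eq]

theorem inversion_round {σ : ℕ} (T : List (Fin σ)) {x : ℕ} (hx : x < (lyndonFactors T).length)
    {i : ℕ} (hi : i ≤ (lyndonFactors T)[x].length) :
    invStep^[i] (invStart (lift (bbwt (((lyndonFactors T).take x).flatten ++
      (lyndonFactors T)[x])))) =
      ⟨delimText (textRows (WithBot.some : Fin σ → WithBot (Fin σ)) ((lyndonFactors T).take x))
          (lift ((lyndonFactors T)[x].drop i)),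
        delimPos (textRows (WithBot.some : Fin σ → WithBot (Fin σ)) ((lyndonFactors T).take x))
          (lift ((lyndonFactors T)[x].drop i)) + 1,
        lift ((lyndonFactors T)[x].take i)⟩ := by
  set fs := (lyndonFactors T).take x with hfs
  set F := (lyndonFactors T)[x] with hF
  set φ : Fin σ → WithBot (Fin σ) := WithBot.some with hφ
  have hle := lyndonFactors_take_le T hx
  have hne : ∀ f ∈ fs, f ≠ [] := fun f hf => (hle f hf).1.1
  have hLy := textRows_isLyndon (coe_strictMono σ) hle
  rw [← hfs, ← hF, ← lift_eq, ← hφ] at hLy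
  have hFL : IsLyndon (lift F) := by
    rw [lift_eq]
    exact ((lyndonFactors_spec T).2.1 F (List.getElem_mem hx)).map (coe_strictMono σ)
  induction i with
  | zero =>
    -- The cyclic last factor is cut open; what is then missing for `delimText` is just the `$` that
    -- `invStart` inserts.
    have h1 : lift (bbwt (fs.flatten ++ F)) = bwtOf (textRows φ fs + innerRows (lift F) bots) := by
      have h2 : fs.flatten ++ F = ((lyndonFactors T).take (x + 1)).flatten := by
        rw [List.take_succ_eq_append_getElem hx, List.flatten_append]; simp [hfs, hF]
      have h3 := map_bbwt_flatten (coe_strictMono σ) T (x + 1)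
      rw [h2, lift_eq, h3, List.take_succ_eq_append_getElem hx, textRows, List.map_append,
        factorRows_append, List.map_singleton, factorRows_singleton, ← hF, ← lift_eq]
      exact bwtOf_add_conjRows hFL hLy
        fun h => bot_notMem_lift F (List.mem_of_mem_tail h)
    have h2 : delimPos (textRows φ fs) (lift F) = 1 :=
      delimPos_of_isLyndon hFL hLy (bot_notMem_lift F)
    rw [Function.iterate_zero, id, List.drop_zero, List.take_zero, delimText_eq, h2, invStart, h1]
    rfl
  | succ i ih =>
    rw [Function.iterate_succ_apply', ih (by omega), List.drop_eq_getElem_cons hi]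
    have hb := bot_notMem_lift (F.drop (i + 1))
    have hE := extensions_textRows φ hne
    have hE' := textRows_ne_bot (φ := φ) (fun a => WithBot.coe_ne_bot) hne
    have hp := delimPos_cons hE hE' hb (c := φ F[i]) WithBot.coe_ne_bot
    have hlc : lift (F[i] :: F.drop (i + 1)) = φ F[i] :: lift (F.drop (i + 1)) := by
      rw [lift_eq, lift_eq]; rfl
    rw [hlc, delimText_cons hE' hb, invStep_eq WithBot.coe_ne_bot (delimText_getElem _ _) hp]
    · congr 1
      rw [List.take_succ_eq_append_getElem hi, lift_eq, lift_eq, List.map_append]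
      rfl
    · have := delimPos_le (textRows φ fs) (φ F[i] :: lift (F.drop (i + 1)))
      rw [length_bwtOf, add_innerRows_cons] at this
      rw [delimText, length_bwtOf, add_innerRows_cons]
      simpa using this

theorem inversion_invariant {σ : ℕ} (T : List (Fin σ)) (x : ℕ)
    (hx : x < (lyndonFactors T).length) :
    let P : List (Fin σ) := ((lyndonFactors T).take x).flatten
    let F : List (Fin σ) := (lyndonFactors T)[x]
    let state : ℕ → InvState σ := fun i => invStep^[i] (invStart (lift (bbwt (P ++ F))))
    (∀ i ≤ F.length,
      (state i).text = bbwt (lift P ++ ⊥ :: lift (F.drop i)) ∧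
      0 < (state i).pos ∧ (state i).text[(state i).pos - 1]? = some ⊥ ∧
      ((state i).pos = 1 ↔ i = F.length) ∧
      (state i).out = lift (F.take i)) ∧
    (state F.length).text.eraseIdx 0 = lift (bbwt P) := by
  intro P F state
  set φ : Fin σ → WithBot (Fin σ) := WithBot.some with hφ
  have hne : ∀ f ∈ (lyndonFactors T).take x, f ≠ [] :=
    fun f hf => (lyndonFactors_take_le T hx f hf).1.1
  have hE := extensions_textRows φ hne
  have hE' := textRows_ne_bot (φ := φ) (fun a => WithBot.coe_ne_bot) hne
  have hst : ∀ i ≤ F.length, state i = ⟨delimText (textRows φ ((lyndonFactors T).take x))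
      (lift (F.drop i)), delimPos (textRows φ ((lyndonFactors T).take x)) (lift (F.drop i)) + 1,
      lift (F.take i)⟩ := fun i hi => inversion_round T hx hi
  refine ⟨fun i hi => ?_, ?_⟩
  · rw [hst i hi]
    refine ⟨?_, Nat.succ_pos _, delimText_getElem _ _, ?_, rfl⟩
    · have := bbwt_delim (coe_strictMono σ) (fun a => WithBot.coe_ne_bot) P
        (bot_notMem_lift (F.drop i))
      rw [lyndonFactors_take, ← lift_eq] at this
      exact this.symm
    · rw [Nat.add_eq_right]
      rcases hi.lt_or_eq with h | h
      · have := delimPos_cons_pos hE hE' (bot_notMem_lift (F.drop (i + 1))) (c := φ F[i])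
          WithBot.coe_ne_bot
        have hlc : lift (F.drop i) = φ F[i] :: lift (F.drop (i + 1)) := by
          rw [List.drop_eq_getElem_cons h, lift_eq, lift_eq]; rfl
        rw [hlc]
        exact ⟨fun h' => by omega, fun h' => by omega⟩
      · have hlc : lift (F.drop i) = [] := by rw [h, List.drop_length, lift_eq]; rfl
        rw [hlc, delimPos_nil]
        exact ⟨fun _ => h, fun _ => rfl⟩
  · rw [hst F.length le_rfl, List.drop_length]
    have := map_bbwt_flatten (coe_strictMono σ) T x
    have hl : lift ([] : List (Fin σ)) = [] := lift_eq _
    rw [hl, delimText_nil, lift_eq (bbwt P), this]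
    rfl

theorem length_bbwt (T : List α) : (bbwt T).length = T.length := by
  have := congrArg List.length (map_bbwt (WithBot.coe_strictMono : StrictMono ((↑) : α → WithBot α)) T)
  rw [List.length_map, length_bwtOf, card_factorRows, ← List.map_flatten, List.length_map,
    (lyndonFactors_spec T).1] at this
  exact this

theorem extracts_bbwt {σ : ℕ} (T : List (Fin σ)) :
    Extracts (lift (bbwt T)) ((lyndonFactors T).reverse.map lift) := by
  have key : ∀ x ≤ (lyndonFactors T).length, Extracts
      (lift (bbwt ((lyndonFactors T).take x).flatten))
      (((lyndonFactors T).take x).reverse.map lift) := by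
    intro x
    induction x with
    | zero =>
      intro _
      have : bbwt ([] : List (Fin σ)) = [] := List.length_eq_zero_iff.1 (length_bbwt _)
      simpa [this, lift_eq] using Extracts.done
    | succ x ih =>
      intro hx
      obtain ⟨h1, h2⟩ := inversion_invariant T x hx
      have h3 := h1 (lyndonFactors T)[x].length le_rfl
      have h4 := List.length_pos_iff.2 ((lyndonFactors_spec T).2.1 _ (List.getElem_mem hx)).1
      have := Extracts.round
        (lift (bbwt (((lyndonFactors T).take x).flatten ++ (lyndonFactors T)[x])))
        (lyndonFactors T)[x].length (((lyndonFactors T).take x).reverse.map lift)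
        (fun h => by
          have := congrArg List.length h
          rw [length_lift, length_bbwt, List.length_append, List.length_nil] at this
          omega)
        (fun i hi h => by
          have := (h1 i hi.le).2.2.2.1.1 h
          omega)
        (h3.2.2.2.1.2 rfl) (h2 ▸ ih (by omega))
      rw [h3.2.2.2.2, List.take_length] at this
      rw [List.take_succ_eq_append_getElem hx, List.flatten_append, List.flatten_singleton,
        List.reverse_append, List.map_append]
      exact this
  have := key _ le_rfl
  rwa [List.take_length, (lyndonFactors_spec T).1] at this

end inversion

/-! ### Executions on the word RAM -/

section ram

variable {K : ℕ} {w : ℕ} {prog : Program K} {σ B : ℕ}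

/-- The restrictions on a configuration: memory contents and a bound on all registers. -/
def Good (σ B : ℕ) (c : Config K) : Prop :=
  (∀ v ∈ c.mem, v ≤ σ) ∧ c.mem.count 0 ≤ 1 ∧ ∀ i, c.reg i ≤ B

/-- `Exec w prog σ B c n d`: from `c` the machine reaches `d` in `n` steps, through good
configurations. -/
inductive Exec (w : ℕ) (prog : Program K) (σ B : ℕ) : Config K → ℕ → Config K → Prop
  | refl (c : Config K) (h : Good σ B c) : Exec w prog σ B c 0 c
  | head (c d e : Config K) (n : ℕ) (h : Good σ B c) (hs : step w prog c = some d)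
      (he : Exec w prog σ B d n e) : Exec w prog σ B c (n + 1) e

theorem Exec.trans {c d e : Config K} {m n : ℕ} (h1 : Exec w prog σ B c m d)
    (h2 : Exec w prog σ B d n e) : Exec w prog σ B c (m + n) e := by
  induction h1 with
  | refl => rwa [Nat.zero_add]
  | head c d' _ m h hs _ ih =>
    rw [Nat.add_right_comm]
    exact .head _ _ _ _ h hs (ih h2)

theorem run_succ (c : Config K) (s : ℕ) :
    run w prog c (s + 1) = (step w prog c).bind fun d => run w prog d s := by
  induction s with
  | zero => simp [run]
  | succ s ih =>
    rw [run, ih]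
    cases step w prog c <;> rfl

theorem Exec.run_eq {c d : Config K} {n : ℕ} (h : Exec w prog σ B c n d) :
    run w prog c n = some d := by
  induction h with
  | refl => rfl
  | head c d e n h hs _ ih => rw [run_succ, hs]; exact ih

theorem Exec.good {c d : Config K} {n : ℕ} (h : Exec w prog σ B c n d) :
    ∀ i ≤ n, ∃ e, run w prog c i = some e ∧ Good σ B e := by
  induction h with
  | refl c h =>
    intro i hi
    obtain rfl : i = 0 := by omega
    exact ⟨c, rfl, h⟩
  | head c d e n h hs _ ih =>
    intro i hi
    cases i with
    | zero => exact ⟨c, rfl, h⟩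
    | succ i =>
      rw [run_succ, hs]
      exact ih i (by omega)

theorem Exec.good_right {c d : Config K} {n : ℕ} (h : Exec w prog σ B c n d) : Good σ B d := by
  induction h <;> assumption

/-- From `c` the machine reaches a configuration with `Q` in at most `t` steps, through good
configurations. -/
def Reaches (w : ℕ) (prog : Program K) (σ B : ℕ) (c : Config K) (t : ℕ) (Q : Config K → Prop) :
    Prop :=
  ∃ n ≤ t, ∃ d, Exec w prog σ B c n d ∧ Q d

variable {pc t : ℕ} {reg reg' : Fin (K + 1) → ℕ} {mem : List ℕ} {Q : Config K → Prop}

theorem Reaches.done {c : Config K} (h : Good σ B c) (hQ : Q c) : Reaches w prog σ B c t Q :=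
  ⟨0, Nat.zero_le _, c, .refl c h, hQ⟩

theorem Reaches.mono {c : Config K} {t' : ℕ} {Q' : Config K → Prop}
    (h : Reaches w prog σ B c t Q) (ht : t ≤ t') (hQ : ∀ d, Q d → Q' d) :
    Reaches w prog σ B c t' Q' := by
  obtain ⟨n, hn, d, hd, hq⟩ := h
  exact ⟨n, hn.trans ht, d, hd, hQ d hq⟩

theorem Reaches.bind {c : Config K} {t' : ℕ} {Q' : Config K → Prop}
    (h : Reaches w prog σ B c t Q)
    (h' : ∀ d, Good σ B d → Q d → Reaches w prog σ B d t' Q') :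
    Reaches w prog σ B c (t + t') Q' := by
  obtain ⟨n, hn, d, hd, hq⟩ := h
  obtain ⟨m, hm, e, he, hq'⟩ := h' d hd.good_right hq
  exact ⟨n + m, Nat.add_le_add hn hm, e, hd.trans he, hq'⟩

theorem Reaches.head {c d : Config K} (h : Good σ B c) (hs : step w prog c = some d)
    (hd : Reaches w prog σ B d t Q) : Reaches w prog σ B c (t + 1) Q := by
  obtain ⟨n, hn, e, he, hq⟩ := hd
  exact ⟨n + 1, by omega, e, .head _ _ _ _ h hs he, hq⟩

theorem Good.update (h : Good σ B ⟨pc, reg, mem⟩) (pc' : ℕ) (d : Fin (K + 1)) {v : ℕ} (hv : v ≤ B) :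
    Good σ B ⟨pc', Function.update reg d v, mem⟩ := by
  refine ⟨h.1, h.2.1, fun i => ?_⟩
  by_cases hi : i = d
  · subst hi; simpa using hv
  · simpa [hi] using h.2.2 i

/-- The rules for single instructions take the rest of the run as a continuation. Separate variables
for the new value and registers allow a convenient form of both, and `B < 2 ^ w` makes the reduction
modulo `2 ^ w` vacuous. -/
theorem Reaches.const {d : Fin (K + 1)} {v : ℕ} (hp : prog[pc]? = some (.const d v))
    (h : Good σ B ⟨pc, reg, mem⟩) (hu : Function.update reg d v = reg') (hv : v ≤ B)
    (hw : B < 2 ^ w)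
    (k : Good σ B ⟨pc + 1, reg', mem⟩ → Reaches w prog σ B ⟨pc + 1, reg', mem⟩ t Q) :
    Reaches w prog σ B ⟨pc, reg, mem⟩ (t + 1) Q := by
  subst hu
  exact .head h (by simp [step, hp, Nat.mod_eq_of_lt (hv.trans_lt hw)]) (k (h.update _ d hv))

theorem Reaches.move {d a : Fin (K + 1)} {v : ℕ} (hp : prog[pc]? = some (.move d a))
    (h : Good σ B ⟨pc, reg, mem⟩) (hu : Function.update reg d v = reg') (hv : reg a = v)
    (k : Good σ B ⟨pc + 1, reg', mem⟩ → Reaches w prog σ B ⟨pc + 1, reg', mem⟩ t Q) :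
    Reaches w prog σ B ⟨pc, reg, mem⟩ (t + 1) Q := by
  subst hu hv
  exact .head h (by simp [step, hp]) (k (h.update _ d (h.2.2 a)))

theorem Reaches.add {d a b : Fin (K + 1)} {v : ℕ} (hp : prog[pc]? = some (.op .add d a b))
    (h : Good σ B ⟨pc, reg, mem⟩) (hu : Function.update reg d v = reg') (hv : reg a + reg b = v)
    (hle : v ≤ B) (hw : B < 2 ^ w)
    (k : Good σ B ⟨pc + 1, reg', mem⟩ → Reaches w prog σ B ⟨pc + 1, reg', mem⟩ t Q) :
    Reaches w prog σ B ⟨pc, reg, mem⟩ (t + 1) Q := by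
  subst hu hv
  exact .head h (by simp [step, hp, BinOp.eval, Nat.mod_eq_of_lt (hle.trans_lt hw)])
    (k (h.update _ d hle))

theorem Reaches.sub {d a b : Fin (K + 1)} {v : ℕ} (hp : prog[pc]? = some (.op .sub d a b))
    (h : Good σ B ⟨pc, reg, mem⟩) (hu : Function.update reg d v = reg') (hv : reg a = v + reg b)
    (hw : B < 2 ^ w)
    (k : Good σ B ⟨pc + 1, reg', mem⟩ → Reaches w prog σ B ⟨pc + 1, reg', mem⟩ t Q) :
    Reaches w prog σ B ⟨pc, reg, mem⟩ (t + 1) Q := by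
  subst hu
  have ha : reg a ≤ B := h.2.2 a
  refine .head h ?_ (k (h.update _ d (by omega)))
  have : (reg a + 2 ^ w - reg b) % 2 ^ w = v := by
    rw [show reg a + 2 ^ w - reg b = v + 2 ^ w by omega, Nat.add_mod_right,
      Nat.mod_eq_of_lt (by omega)]
  simp [step, hp, BinOp.eval, this]

theorem Reaches.load {d a : Fin (K + 1)} {v : ℕ} (hp : prog[pc]? = some (.load d a))
    (h : Good σ B ⟨pc, reg, mem⟩) (hu : Function.update reg d v = reg')
    (hv : mem[reg a]? = some v) (hB : σ ≤ B)
    (k : Good σ B ⟨pc + 1, reg', mem⟩ → Reaches w prog σ B ⟨pc + 1, reg', mem⟩ t Q) :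
    Reaches w prog σ B ⟨pc, reg, mem⟩ (t + 1) Q := by
  subst hu
  exact .head h (by simp [step, hp, hv])
    (k (h.update _ d ((h.1 v (List.mem_of_getElem? hv)).trans hB)))

theorem Reaches.store {a b : Fin (K + 1)} {mem' : List ℕ} (hp : prog[pc]? = some (.store a b))
    (h : Good σ B ⟨pc, reg, mem⟩) (ha : reg a < mem.length)
    (hm : mem.set (reg a) (reg b) = mem')
    (h1 : ∀ v ∈ mem', v ≤ σ) (h2 : mem'.count 0 ≤ 1)
    (k : Good σ B ⟨pc + 1, reg, mem'⟩ → Reaches w prog σ B ⟨pc + 1, reg, mem'⟩ t Q) :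
    Reaches w prog σ B ⟨pc, reg, mem⟩ (t + 1) Q := by
  subst hm
  exact .head h (by simp [step, hp, ha]) (k ⟨h1, h2, h.2.2⟩)

theorem Reaches.jump {l : ℕ} (hp : prog[pc]? = some (.jump l)) (h : Good σ B ⟨pc, reg, mem⟩)
    (k : Good σ B ⟨l, reg, mem⟩ → Reaches w prog σ B ⟨l, reg, mem⟩ t Q) :
    Reaches w prog σ B ⟨pc, reg, mem⟩ (t + 1) Q :=
  .head h (by simp [step, hp]) (k h)

theorem Reaches.jumpLt {a b : Fin (K + 1)} {l : ℕ} (hp : prog[pc]? = some (.jumpLt a b l))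
    (h : Good σ B ⟨pc, reg, mem⟩)
    (k1 : reg a < reg b → Good σ B ⟨l, reg, mem⟩ → Reaches w prog σ B ⟨l, reg, mem⟩ t Q)
    (k2 : ¬ reg a < reg b → Good σ B ⟨pc + 1, reg, mem⟩ →
      Reaches w prog σ B ⟨pc + 1, reg, mem⟩ t Q) :
    Reaches w prog σ B ⟨pc, reg, mem⟩ (t + 1) Q := by
  by_cases hab : reg a < reg b
  · exact .head h (by simp [step, hp, hab]) (k1 hab h)
  · exact .head h (by simp [step, hp, hab]) (k2 hab h)

theorem Reaches.jumpEq {a b : Fin (K + 1)} {l : ℕ} (hp : prog[pc]? = some (.jumpEq a b l))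
    (h : Good σ B ⟨pc, reg, mem⟩)
    (k1 : reg a = reg b → Good σ B ⟨l, reg, mem⟩ → Reaches w prog σ B ⟨l, reg, mem⟩ t Q)
    (k2 : reg a ≠ reg b → Good σ B ⟨pc + 1, reg, mem⟩ →
      Reaches w prog σ B ⟨pc + 1, reg, mem⟩ t Q) :
    Reaches w prog σ B ⟨pc, reg, mem⟩ (t + 1) Q := by
  by_cases hab : reg a = reg b
  · exact .head h (by simp [step, hp, hab]) (k1 hab h)
  · exact .head h (by simp [step, hp, hab]) (k2 hab h)

end ram

/-! ### The program -/

/-- The contents of the registers: the number of cells, the constants `1` and `0`, the length of the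
remaining transform, the current position in it, the position of `$` after it, the current character,
the variables of the loops, the rank of the next position, and the target of the shift. -/
structure Regs where
  (total one zero len pos dpos char idx bound thr acc val rank target : ℕ)

/-- The registers as a function. -/
def Regs.get (ρ : Regs) : Fin (13 + 1) → ℕ :=
  ![ρ.total, ρ.one, ρ.zero, ρ.len, ρ.pos, ρ.dpos, ρ.char, ρ.idx, ρ.bound, ρ.thr, ρ.acc, ρ.val,
    ρ.rank, ρ.target]

namespace Regs

variable {ρ : Regs} {v a0 a1 a2 a3 a4 a5 a6 a7 a8 a9 a10 a11 a12 a13 : ℕ}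

/-- These rules keep the registers in record form during symbolic execution. Registers 0 and 2 are
never written. -/
theorem update_1 : Function.update (get ⟨a0, a1, a2, a3, a4, a5, a6, a7, a8, a9, a10, a11, a12, a13⟩) 1 v =
    get ⟨a0, v, a2, a3, a4, a5, a6, a7, a8, a9, a10, a11, a12, a13⟩ := by
  funext i; fin_cases i <;> rfl
theorem update_3 : Function.update (get ⟨a0, a1, a2, a3, a4, a5, a6, a7, a8, a9, a10, a11, a12, a13⟩) 3 v =
    get ⟨a0, a1, a2, v, a4, a5, a6, a7, a8, a9, a10, a11, a12, a13⟩ := by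
  funext i; fin_cases i <;> rfl
theorem update_4 : Function.update (get ⟨a0, a1, a2, a3, a4, a5, a6, a7, a8, a9, a10, a11, a12, a13⟩) 4 v =
    get ⟨a0, a1, a2, a3, v, a5, a6, a7, a8, a9, a10, a11, a12, a13⟩ := by
  funext i; fin_cases i <;> rfl
theorem update_5 : Function.update (get ⟨a0, a1, a2, a3, a4, a5, a6, a7, a8, a9, a10, a11, a12, a13⟩) 5 v =
    get ⟨a0, a1, a2, a3, a4, v, a6, a7, a8, a9, a10, a11, a12, a13⟩ := by
  funext i; fin_cases i <;> rfl
theorem update_6 : Function.update (get ⟨a0, a1, a2, a3, a4, a5, a6, a7, a8, a9, a10, a11, a12, a13⟩) 6 v =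
    get ⟨a0, a1, a2, a3, a4, a5, v, a7, a8, a9, a10, a11, a12, a13⟩ := by
  funext i; fin_cases i <;> rfl
theorem update_7 : Function.update (get ⟨a0, a1, a2, a3, a4, a5, a6, a7, a8, a9, a10, a11, a12, a13⟩) 7 v =
    get ⟨a0, a1, a2, a3, a4, a5, a6, v, a8, a9, a10, a11, a12, a13⟩ := by
  funext i; fin_cases i <;> rfl
theorem update_8 : Function.update (get ⟨a0, a1, a2, a3, a4, a5, a6, a7, a8, a9, a10, a11, a12, a13⟩) 8 v =
    get ⟨a0, a1, a2, a3, a4, a5, a6, a7, v, a9, a10, a11, a12, a13⟩ := by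
  funext i; fin_cases i <;> rfl
theorem update_9 : Function.update (get ⟨a0, a1, a2, a3, a4, a5, a6, a7, a8, a9, a10, a11, a12, a13⟩) 9 v =
    get ⟨a0, a1, a2, a3, a4, a5, a6, a7, a8, v, a10, a11, a12, a13⟩ := by
  funext i; fin_cases i <;> rfl
theorem update_10 : Function.update (get ⟨a0, a1, a2, a3, a4, a5, a6, a7, a8, a9, a10, a11, a12, a13⟩) 10 v =
    get ⟨a0, a1, a2, a3, a4, a5, a6, a7, a8, a9, v, a11, a12, a13⟩ := by
  funext i; fin_cases i <;> rfl
theorem update_11 : Function.update (get ⟨a0, a1, a2, a3, a4, a5, a6, a7, a8, a9, a10, a11, a12, a13⟩) 11 v =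
    get ⟨a0, a1, a2, a3, a4, a5, a6, a7, a8, a9, a10, v, a12, a13⟩ := by
  funext i; fin_cases i <;> rfl
theorem update_12 : Function.update (get ⟨a0, a1, a2, a3, a4, a5, a6, a7, a8, a9, a10, a11, a12, a13⟩) 12 v =
    get ⟨a0, a1, a2, a3, a4, a5, a6, a7, a8, a9, a10, a11, v, a13⟩ := by
  funext i; fin_cases i <;> rfl
theorem update_13 : Function.update (get ⟨a0, a1, a2, a3, a4, a5, a6, a7, a8, a9, a10, a11, a12, a13⟩) 13 v =
    get ⟨a0, a1, a2, a3, a4, a5, a6, a7, a8, a9, a10, a11, a12, v⟩ := by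
  funext i; fin_cases i <;> rfl

theorem with_idx (h : v = ρ.idx) : { ρ with idx := v } = ρ := by subst h; rfl

end Regs

/-- Adds to `acc` the number of indices `i` from `idx` to `bound - 1` such that the `i`-th cell holds
a character smaller than `char`, or `char` itself and `i < thr`. -/
def scanCode (base : ℕ) : Program 13 :=
  [.jumpEq 7 8 (base + 9), .load 11 7, .jumpLt 11 6 (base + 6), .jumpLt 6 11 (base + 7),
    .jumpLt 7 9 (base + 6), .jump (base + 7), .op .add 10 10 1, .op .add 7 7 1, .jump base]

/-- Moves the cells from `idx + 1` to `target` one place to the left. -/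
def shiftCode (base : ℕ) : Program 13 :=
  [.jumpEq 7 13 (base + 6), .op .add 8 7 1, .load 11 8, .store 7 11, .move 7 8, .jump base]

/-- Extracts the Lyndon factors from the right to the left, each of them from its last character
to its first one. The extracted characters are stored behind the remaining transform, as plain text
or, if `conv`, as a BWT. -/
def inversion (conv : Bool) : Program 13 :=
  [.const 1 1, .op .sub 3 0 (if conv then 1 else 2), .move 5 3,
    .jumpEq 3 2 47, .move 4 2,
    .load 6 4, .move 7 2, .move 8 3, .move 9 4, .move 10 2] ++
  scanCode 10 ++
  [.move 12 10, .op .sub 10 3 1, .move 8 (if conv then 0 else 3), .move 9 5] ++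
  scanCode 23 ++
  [.move 13 10, .store (if conv then 5 else 4) 6, .move 7 4] ++
  shiftCode 35 ++
  [.store 13 (if conv then 2 else 6), .move 5 13, .op .sub 3 3 1, .jumpEq 12 2 3, .op .sub 4 12 1,
    .jump 5]

/-! ### Correctness of the scanning and shifting loops -/

section loops

variable {w : ℕ} {prog : Program 13} {σ B : ℕ}

theorem drop_take_eq_cons {M : List ℕ} {j b : ℕ} (hj : j < b) (hb : b ≤ M.length) :
    (M.take b).drop j = M[j] :: (M.take b).drop (j + 1) := by
  rw [List.drop_eq_getElem_cons (by rw [List.length_take]; omega), List.getElem_take]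

theorem countLt_cons (x c : ℕ) (l : List ℕ) :
    countLt (x :: l) c = countLt l c + if x < c then 1 else 0 := by
  simp [countLt, List.countP_cons]

theorem countLt_add_count_le (l : List ℕ) (c t : ℕ) :
    countLt l c + (l.take t).count c ≤ l.length := by
  induction l generalizing t with
  | nil => simp [countLt]
  | cons x l ih =>
    rw [countLt_cons, List.length_cons]
    cases t with
    | zero =>
      have := ih 0
      simp at this ⊢
      split_ifs <;> omega
    | succ t =>
      have := ih t
      rw [List.take_succ_cons, List.count_cons]
      by_cases h : x = c
      · subst h; simp; omega
      · simp [h]; split_ifs <;> omega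

/-- Induction on the number `k` of cells left. The longest path through the loop, for a character
equal to `char` in front of `thr`, has 8 instructions, and the exit test is one more. -/
theorem scan_reaches {base : ℕ} (hcode : ∀ i < 9, prog[base + i]? = (scanCode base)[i]?)
    (hw : B < 2 ^ w) (hB : σ ≤ B) {M : List ℕ} {t : ℕ} {Q : Config 13 → Prop} (k : ℕ) :
    ∀ (ρ : Regs), ρ.bound = ρ.idx + k → ρ.bound ≤ M.length → ρ.bound ≤ B → ρ.acc + k ≤ B →
    ρ.one = 1 → Good σ B ⟨base, ρ.get, M⟩ →
    (∀ x, Good σ B ⟨base + 9, { ρ with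
        idx := ρ.bound
        val := x
        acc := ρ.acc + (countLt ((M.take ρ.bound).drop ρ.idx) ρ.char +
          (((M.take ρ.bound).drop ρ.idx).take (ρ.thr - ρ.idx)).count ρ.char) }.get, M⟩ →
      Reaches w prog σ B ⟨base + 9, { ρ with
        idx := ρ.bound
        val := x
        acc := ρ.acc + (countLt ((M.take ρ.bound).drop ρ.idx) ρ.char +
          (((M.take ρ.bound).drop ρ.idx).take (ρ.thr - ρ.idx)).count ρ.char) }.get, M⟩ t Q) →
    Reaches w prog σ B ⟨base, ρ.get, M⟩ (t + (8 * k + 1)) Q := by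
  induction k with
  | zero =>
    intro ρ h1 h2 h3 h4 h5 hG hk
    refine Reaches.jumpEq (hcode 0 (by omega)) hG (fun _ hG => ?_)
      fun h => absurd (h1.symm : ρ.idx = ρ.bound) h
    have h6 : (M.take ρ.bound).drop ρ.idx = [] := by
      rw [List.drop_eq_nil_iff, List.length_take]; omega
    have := hk ρ.val
    rw [h6] at this
    simp only [countLt, List.countP_nil, List.take_nil, List.count_nil, Nat.add_zero] at this
    change Good σ B ⟨_, Regs.get { ρ with idx := ρ.bound }, _⟩ →
      Reaches w prog σ B ⟨_, Regs.get { ρ with idx := ρ.bound }, _⟩ _ _ at this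
    rw [Regs.with_idx h1] at this
    exact this hG
  | succ k ih =>
    intro ρ h1 h2 h3 h4 h5 hG hk
    have hj : ρ.idx < M.length := by omega
    rw [drop_take_eq_cons (by omega) h2] at hk
    -- the end of the loop body
    have inc : ∀ a ≤ ρ.acc + 1, a = ρ.acc + ((if M[ρ.idx] < ρ.char then 1 else 0) +
        if M[ρ.idx] = ρ.char ∧ ρ.idx < ρ.thr then 1 else 0) →
        Good σ B ⟨base + 7, { ρ with val := M[ρ.idx], acc := a }.get, M⟩ →
        Reaches w prog σ B ⟨base + 7, { ρ with val := M[ρ.idx], acc := a }.get, M⟩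
          (t + (8 * k + 1) + 2) Q := by
      intro a ha ha' hG
      refine Reaches.add (hcode 7 (by omega)) hG Regs.update_7
        (show ρ.idx + ρ.one = ρ.idx + 1 by rw [h5]) (by omega) hw fun hG => ?_
      refine Reaches.jump (hcode 8 (by omega)) hG fun hG => ?_
      refine ih _ ?_ h2 h3 ?_ h5 hG ?_
      · dsimp only; omega
      · dsimp only; omega
      intro x hG
      have hcount : a + (countLt ((M.take ρ.bound).drop (ρ.idx + 1)) ρ.char +
          (((M.take ρ.bound).drop (ρ.idx + 1)).take (ρ.thr - (ρ.idx + 1))).count ρ.char) =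
          ρ.acc + (countLt (M[ρ.idx] :: (M.take ρ.bound).drop (ρ.idx + 1)) ρ.char +
          ((M[ρ.idx] :: (M.take ρ.bound).drop (ρ.idx + 1)).take (ρ.thr - ρ.idx)).count ρ.char) := by
        rw [countLt_cons, ha']
        by_cases ht : ρ.idx < ρ.thr
        · rw [show ρ.thr - ρ.idx = (ρ.thr - (ρ.idx + 1)) + 1 by omega, List.take_succ_cons,
            List.count_cons]
          simp only [ht, and_true, beq_iff_eq]
          omega
        · rw [show ρ.thr - ρ.idx = 0 by omega, show ρ.thr - (ρ.idx + 1) = 0 by omega]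
          simp only [ht, and_false, List.take_zero, List.count_nil, if_false]
          omega
      dsimp only at hG ⊢
      rw [hcount] at hG ⊢
      exact hk x hG
    have inc' : (M[ρ.idx] < ρ.char ∨ M[ρ.idx] = ρ.char ∧ ρ.idx < ρ.thr) →
        Good σ B ⟨base + 6, { ρ with val := M[ρ.idx] }.get, M⟩ →
        Reaches w prog σ B ⟨base + 6, { ρ with val := M[ρ.idx] }.get, M⟩
          (t + (8 * k + 1) + 3) Q := by
      intro hc hG
      refine Reaches.add (hcode 6 (by omega)) hG Regs.update_10
        (show ρ.acc + ρ.one = ρ.acc + 1 by rw [h5]) (by omega) hw fun hG => ?_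
      refine inc _ le_rfl ?_ hG
      rcases hc with hc | hc
      · rw [if_pos hc, if_neg (fun h => hc.ne h.1)]
      · rw [if_neg (fun h => h.ne hc.1), if_pos hc]
    rw [show t + (8 * (k + 1) + 1) = t + (8 * k + 1) + 3 + 5 by omega]
    refine Reaches.jumpEq (t := t + (8 * k + 1) + 3 + 4) (hcode 0 (by omega)) hG
      (fun h => absurd (show ρ.idx = ρ.bound from h) (by omega)) fun _ hG => ?_
    refine Reaches.load (t := t + (8 * k + 1) + 3 + 3) (hcode 1 (by omega)) hG
      Regs.update_11 (List.getElem?_eq_getElem hj) hB fun hG => ?_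
    refine Reaches.jumpLt (t := t + (8 * k + 1) + 3 + 2) (hcode 2 (by omega)) hG
      (fun h hG => (inc' (Or.inl h) hG).mono (by omega) fun _ h => h) fun hlt hG => ?_
    refine Reaches.jumpLt (t := t + (8 * k + 1) + 3 + 1) (hcode 3 (by omega)) hG
      (fun h hG => (inc ρ.acc (Nat.le_succ _) ?_ hG).mono (by omega) fun _ h => h) fun hgt hG => ?_
    · have h : ρ.char < M[ρ.idx] := h
      rw [if_neg h.not_gt, if_neg (fun h' => h.ne' h'.1)]; rfl
    have he : M[ρ.idx] = ρ.char := le_antisymm (not_lt.1 hgt) (not_lt.1 hlt)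
    refine Reaches.jumpLt (t := t + (8 * k + 1) + 3) (hcode 4 (by omega)) hG
      (fun h hG => inc' (Or.inr ⟨he, h⟩) hG) fun hthr hG => ?_
    refine Reaches.jump (t := t + (8 * k + 1) + 2) (hcode 5 (by omega)) hG fun hG => ?_
    refine inc ρ.acc (Nat.le_succ _) ?_ hG
    have hthr : ¬ ρ.idx < ρ.thr := hthr
    rw [if_neg (fun h => h.ne he), if_neg (fun h => hthr h.2)]; rfl

/-- Invariant of the shift: copying a cell to the left moves the superfluous cell one place to the
right without affecting the list of the others. -/
theorem set_eraseIdx_succ {M : List ℕ} {j : ℕ} (hj : j + 1 < M.length) :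
    (M.set j M[j + 1]).eraseIdx (j + 1) = M.eraseIdx j := by
  apply List.ext_getElem?
  intro i
  rw [List.getElem?_eraseIdx, List.getElem?_eraseIdx]
  simp only [List.getElem?_set]
  rcases lt_trichotomy i j with h | rfl | h
  · rw [if_pos (by omega), if_neg (by omega), if_pos h]
  · rw [if_pos (by omega), if_pos rfl, if_pos (by omega), if_neg (by omega),
      List.getElem?_eq_getElem hj]
  · rw [if_neg (by omega), if_neg (by omega), if_neg (by omega)]

/-- The values of the cells while no cell holds `$`. -/
def Plain (σ : ℕ) (M : List ℕ) : Prop := ∀ v ∈ M, v ≠ 0 ∧ v ≤ σ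

theorem Plain.count_zero {M : List ℕ} (h : Plain σ M) : M.count 0 = 0 :=
  List.count_eq_zero.2 fun h0 => (h 0 h0).1 rfl

theorem Plain.set {M : List ℕ} (h : Plain σ M) (i : ℕ) {v : ℕ} (hv : v ≠ 0 ∧ v ≤ σ) :
    Plain σ (M.set i v) := by
  intro x hx
  rcases List.mem_or_eq_of_mem_set hx with hx | rfl
  · exact h x hx
  · exact hv

/-- At the end the cell `target` still holds its old value, a stale copy that the caller overwrites.
As only non-zero values are copied, no second `$` arises on the way. -/
theorem shift_reaches {base : ℕ} (hcode : ∀ i < 6, prog[base + i]? = (shiftCode base)[i]?)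
    (hw : B < 2 ^ w) (hB : σ ≤ B) {t : ℕ} {Q : Config 13 → Prop} (k : ℕ) :
    ∀ (ρ : Regs) (M : List ℕ) (_ : ρ.target = ρ.idx + k) (h2 : ρ.target < M.length),
    ρ.target ≤ B → ρ.one = 1 → Plain σ M → Good σ B ⟨base, ρ.get, M⟩ →
    (∀ x b, Good σ B ⟨base + 6, { ρ with idx := ρ.target, val := x, bound := b }.get,
        (M.eraseIdx ρ.idx).insertIdx ρ.target M[ρ.target]⟩ →
      Plain σ ((M.eraseIdx ρ.idx).insertIdx ρ.target M[ρ.target]) →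
      Reaches w prog σ B ⟨base + 6, { ρ with idx := ρ.target, val := x, bound := b }.get,
        (M.eraseIdx ρ.idx).insertIdx ρ.target M[ρ.target]⟩ t Q) →
    Reaches w prog σ B ⟨base, ρ.get, M⟩ (t + (6 * k + 1)) Q := by
  induction k with
  | zero =>
    intro ρ M h1 h2 h3 h4 hM hG hk
    refine Reaches.jumpEq (hcode 0 (by omega)) hG (fun _ hG => ?_)
      fun h => absurd (h1.symm : ρ.idx = ρ.target) h
    have h5 : (M.eraseIdx ρ.idx).insertIdx ρ.target M[ρ.target] = M := by
      have : ρ.target = ρ.idx := h1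
      simp only [this]
      exact List.insertIdx_eraseIdx_getElem (by omega)
    have := hk ρ.val ρ.bound
    rw [h5] at this
    change Good σ B ⟨_, Regs.get { ρ with idx := ρ.target }, _⟩ → _ →
      Reaches w prog σ B ⟨_, Regs.get { ρ with idx := ρ.target }, _⟩ _ _ at this
    rw [Regs.with_idx h1] at this
    exact this hG hM
  | succ k ih =>
    intro ρ M h1 h2 h3 h4 hM hG hk
    have hj : ρ.idx + 1 < M.length := by omega
    rw [show t + (6 * (k + 1) + 1) = t + (6 * k + 1) + 1 + 1 + 1 + 1 + 1 + 1 by omega]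
    refine Reaches.jumpEq (hcode 0 (by omega)) hG
      (fun h => absurd (show ρ.idx = ρ.target from h) (by omega)) fun _ hG => ?_
    refine Reaches.add (hcode 1 (by omega)) hG Regs.update_8
      (show ρ.idx + ρ.one = ρ.idx + 1 by rw [h4]) (by omega) hw fun hG => ?_
    refine Reaches.load (hcode 2 (by omega)) hG Regs.update_11
      (List.getElem?_eq_getElem hj) hB fun hG => ?_
    have hM' := hM.set ρ.idx (hM _ (List.getElem_mem hj))
    refine Reaches.store (mem' := M.set ρ.idx M[ρ.idx + 1]) (hcode 3 (by omega)) hG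
      (show ρ.idx < _ by omega) rfl
      (fun v hv => (hM' v hv).2) (hM'.count_zero.le.trans (Nat.zero_le _)) fun hG => ?_
    refine Reaches.move (v := ρ.idx + 1) (hcode 4 (by omega)) hG Regs.update_7 rfl fun hG => ?_
    refine Reaches.jump (hcode 5 (by omega)) hG fun hG => ?_
    refine ih _ _ ?_ ?_ h3 h4 hM' hG ?_
    · dsimp only; omega
    · rw [List.length_set]; exact h2
    intro x b hG hP
    have h5 : ((M.set ρ.idx M[ρ.idx + 1]).eraseIdx (ρ.idx + 1)).insertIdx ρ.target
        ((M.set ρ.idx M[ρ.idx + 1])[ρ.target]'(by rw [List.length_set]; exact h2)) =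
        (M.eraseIdx ρ.idx).insertIdx ρ.target M[ρ.target] := by
      rw [set_eraseIdx_succ hj, List.getElem_set_of_ne (by omega)]
    dsimp only at hG hP ⊢
    rw [h5] at hG hP ⊢
    exact hk x b hG hP

end loops

/-! ### One pass of the program through its inner loop -/

section body

variable {w σ B : ℕ}

theorem inversion_scan₁ (conv : Bool) :
    ∀ i < 9, (inversion conv)[10 + i]? = (scanCode 10)[i]? := by
  intro i hi
  interval_cases i <;> rfl

theorem inversion_scan₂ (conv : Bool) :
    ∀ i < 9, (inversion conv)[23 + i]? = (scanCode 23)[i]? := by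
  intro i hi
  interval_cases i <;> rfl

theorem inversion_shift (conv : Bool) :
    ∀ i < 6, (inversion conv)[35 + i]? = (shiftCode 35)[i]? := by
  intro i hi
  interval_cases i <;> rfl

/-- The number of characters in the cells `a, …, b - 1` that are smaller than `c`, or equal to `c`
and in front of cell `t`. -/
def segmentRank (M : List ℕ) (a b t c : ℕ) : ℕ :=
  countLt ((M.take b).drop a) c + (((M.take b).drop a).take (t - a)).count c

theorem segmentRank_le (M : List ℕ) (a b t c : ℕ) : segmentRank M a b t c ≤ b - a := by
  refine (countLt_add_count_le _ _ _).trans ?_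
  rw [List.length_drop, List.length_take]
  omega

theorem insertIdx_set_self {l : List ℕ} {i a b : ℕ} (h : i ≤ l.length) :
    (l.insertIdx i a).set i b = l.insertIdx i b := by
  apply List.ext_getElem?
  intro j
  rw [List.getElem?_set, List.getElem?_insertIdx, List.getElem?_insertIdx, List.length_insertIdx]
  split_ifs <;> first | rfl | omega

theorem insertIdx_eq_set {l : List ℕ} {i a b : ℕ} (h : i ≤ l.length) :
    l.insertIdx i b = (l.insertIdx i a).set i b := (insertIdx_set_self h).symm

/-- One pass through the inner loop. -/
theorem body_reaches (conv : Bool) (hw : B < 2 ^ w) (hB : σ ≤ B) {M : List ℕ} (hM : M.length ≤ B)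
    {N r q : ℕ} (hN : N ≤ M.length) (hr : r < N) (hq : conv = true → N ≤ q ∧ q < M.length)
    {c : ℕ} (hc : M[r]? = some c) (hP : Plain σ (M.set (if conv then q else r) c))
    {a6 a7 a8 a9 a10 a11 a12 a13 : ℕ}
    (hG : Good σ B ⟨5, Regs.get ⟨M.length, 1, 0, N, r, q, a6, a7, a8, a9, a10, a11, a12, a13⟩, M⟩) :
    Reaches w (inversion conv) σ B
      ⟨5, Regs.get ⟨M.length, 1, 0, N, r, q, a6, a7, a8, a9, a10, a11, a12, a13⟩, M⟩
      (14 * M.length + 30) fun d => ∃ ρ : Regs,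
        ρ.total = M.length ∧ ρ.one = 1 ∧ ρ.zero = 0 ∧ ρ.len = N - 1 ∧
        ρ.dpos = N - 1 + segmentRank M N (if conv then M.length else N) q c ∧
        (segmentRank M 0 N r c ≠ 0 → ρ.pos = segmentRank M 0 N r c - 1) ∧
        d = ⟨if segmentRank M 0 N r c = 0 then 3 else 5, ρ.get,
          ((M.set (if conv then q else r) c).eraseIdx r).insertIdx
            (N - 1 + segmentRank M N (if conv then M.length else N) q c)
            (if conv then 0 else c)⟩ := by
  -- Without conversion the second scan is empty and the target `e` is `N - 1`, directly in front of
  -- the extracted text.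
  set b := if conv then M.length else N with hb
  -- With conversion `c` overwrites the old `$`; otherwise `c` is written back to its own cell. In
  -- both cases no cell holds `$` during the shift.
  set p := if conv then q else r with hp
  set e := N - 1 + segmentRank M N b q c with he
  set cnt := segmentRank M 0 N r c with hcnt
  have hbl : b ≤ M.length := by rw [hb]; split_ifs <;> omega
  have hbN : N ≤ b := by rw [hb]; split_ifs <;> omega
  have hpl : p < M.length := by
    rw [hp]
    cases conv with
    | true => exact (hq rfl).2
    | false => simp only [Bool.false_eq_true, if_false]; omega
  have hcl : cnt ≤ N := segmentRank_le _ _ _ _ _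
  have hel : e < M.length := by
    have := segmentRank_le M N b q c
    omega
  have hre : r ≤ e := by omega
  have hlM : (M.set p c).length = M.length := List.length_set
  have hel' : e < (M.set p c).length := by rw [hlM]; exact hel
  -- The scans together visit `b ≤ M.length` cells at 8 steps each, and the shift moves fewer than
  -- `M.length` cells at 6 steps each.
  refine Reaches.mono (t := 6 + (6 * (e - r) + 1) + 3 + (8 * (b - N) + 1) + 4 + (8 * N + 1) + 5)
    ?_ (by omega) (fun _ h => h)
  refine Reaches.load (t := 6 + (6 * (e - r) + 1) + 3 + (8 * (b - N) + 1) + 4 + (8 * N + 1) + 4)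
    rfl hG Regs.update_6 hc hB fun hG => ?_
  refine Reaches.move (v := 0) rfl hG Regs.update_7 rfl fun hG => ?_
  refine Reaches.move (v := N) rfl hG Regs.update_8 rfl fun hG => ?_
  refine Reaches.move (v := r) rfl hG Regs.update_9 rfl fun hG => ?_
  refine Reaches.move (v := 0) rfl hG Regs.update_10 rfl fun hG => ?_
  refine scan_reaches (inversion_scan₁ conv) hw hB N _ (Nat.zero_add N).symm hN
    (show N ≤ B by omega) (show 0 + N ≤ B by omega) rfl hG fun x hG => ?_
  refine Reaches.move (v := cnt) rfl hG Regs.update_12 (Nat.zero_add _) fun hG => ?_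
  refine Reaches.sub (v := N - 1) rfl hG Regs.update_10 (show N = N - 1 + 1 by omega) hw
    fun hG => ?_
  refine Reaches.move (v := b) rfl hG Regs.update_8 (by cases conv <;> rfl) fun hG => ?_
  refine Reaches.move (v := q) rfl hG Regs.update_9 rfl fun hG => ?_
  refine scan_reaches (inversion_scan₂ conv) hw hB (b - N) _ (show b = N + (b - N) by omega) hbl
    (show b ≤ B by omega) (show N - 1 + (b - N) ≤ B by omega) rfl hG fun x hG => ?_
  refine Reaches.move (v := e) rfl hG Regs.update_13 rfl fun hG => ?_
  refine Reaches.store (mem' := M.set p c) (a := if conv then 5 else 4) (b := 6) rfl hG ?_ ?_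
    (fun v hv => (hP v hv).2) (hP.count_zero.le.trans (Nat.zero_le _)) fun hG => ?_
  · cases conv <;> exact hpl
  · cases conv <;> rfl
  refine Reaches.move (v := r) rfl hG Regs.update_7 rfl fun hG => ?_
  refine shift_reaches (inversion_shift conv) hw hB (e - r) _ _ (show e = r + (e - r) by omega)
    hel' (show e ≤ B by omega) rfl hP hG fun x b' hG hP' => ?_
  have hle : e ≤ ((M.set p c).eraseIdx r).length := by
    rw [List.length_eraseIdx, hlM, if_pos (by omega)]; omega
  have hfin : ∀ v ∈ (((M.set p c).eraseIdx r).insertIdx e (M.set p c)[e]).set e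
      (if conv then 0 else c), v = (if conv then 0 else c) ∨ v ≠ 0 ∧ v ≤ σ := by
    intro v hv
    rcases List.mem_or_eq_of_mem_set hv with hv | hv
    · exact Or.inr (hP' v hv)
    · exact Or.inl hv
  have hcs : c ≠ 0 ∧ c ≤ σ := hP c (List.mem_of_getElem? (i := p) (by
    rw [List.getElem?_set_self hpl]))
  refine Reaches.store (a := 13) (b := if conv then 2 else 6)
    (mem' := ((M.set p c).eraseIdx r).insertIdx e (if conv then 0 else c)) rfl hG ?_ ?_ ?_ ?_
    fun hG => ?_
  · change e < _
    rw [List.length_insertIdx_of_le_length hle]; omega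
  · rw [insertIdx_eq_set (a := (M.set p c)[e]) (b := if conv then 0 else c) hle]
    cases conv <;> rfl
  · intro v hv
    rw [insertIdx_eq_set (a := (M.set p c)[e]) (b := if conv then 0 else c) hle] at hv
    rcases hfin v hv with rfl | h
    · cases conv
      · exact hcs.2
      · exact Nat.zero_le _
    · exact h.2
  · rw [(List.perm_insertIdx _ _ hle).count_eq, List.count_cons]
    have h0 : ((M.set p c).eraseIdx r).count 0 = 0 := by
      rw [List.count_eq_zero]
      exact fun h => (hP 0 (List.mem_of_mem_eraseIdx h)).1 rfl
    rw [h0]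
    split_ifs <;> omega
  refine Reaches.move (v := e) rfl hG Regs.update_5 rfl fun hG => ?_
  refine Reaches.sub (v := N - 1) rfl hG Regs.update_3 (show N = N - 1 + 1 by omega) hw
    fun hG => ?_
  refine Reaches.jumpEq (a := 12) (b := 2) (l := 3) rfl hG (fun h hG => ?_) fun h hG => ?_
  · have h : cnt = 0 := h
    refine Reaches.done hG ⟨_, ?_, ?_, ?_, ?_, ?_, fun h' => absurd h h', by rw [if_pos h]⟩ <;> rfl
  · have h : cnt ≠ 0 := h
    refine Reaches.sub (v := cnt - 1) rfl hG Regs.update_4 (show cnt = cnt - 1 + 1 by omega) hw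
      fun hG => ?_
    refine Reaches.jump (l := 5) rfl hG fun hG => ?_
    refine Reaches.done hG ⟨_, ?_, ?_, ?_, ?_, ?_, fun _ => ?_, by rw [if_neg h]⟩ <;> rfl

end body

/-! ### Extraction of a factor in terms of ranks of keys -/

section ranks

variable {β : Type*} [LinearOrder β]

theorem mem_bwtOf {D : Multiset (Row β)} {a : β} (h : a ∈ bwtOf D) : ∃ ρ ∈ D, (ofLex ρ).2 = a := by
  rw [← Multiset.mem_coe, coe_bwtOf] at h
  exact Multiset.mem_map.1 h

theorem mem_of_mem_innerRows {u : List β} {z : Inf β} {ρ : Row β} (h : ρ ∈ innerRows u z) :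
    (ofLex ρ).2 ∈ u := by
  obtain ⟨t, c, v, rfl, rfl⟩ := mem_innerRows h
  simp

variable [OrderBot β] {fs : List (List β)} {F : List β}

theorem mem_bwtOf_factorRows_add {u : List β} {z : Inf β} {a : β}
    (h : a ∈ bwtOf (factorRows fs + innerRows u z)) : (∃ f ∈ fs, a ∈ f) ∨ a ∈ u := by
  obtain ⟨ρ, hρ, rfl⟩ := mem_bwtOf h
  rcases Multiset.mem_add.1 hρ with hρ | hρ
  · obtain ⟨f, hf, hρ⟩ := mem_factorRows.1 hρ
    exact Or.inl ⟨f, hf, mem_of_mem_innerRows hρ⟩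
  · exact Or.inr (mem_of_mem_innerRows hρ)

/-- No key is below `omega F`. For `t = F` this gives the start position 0; for `t = []` it gives
the stop criterion. -/
theorem keyRank_self (hF : IsLyndon F) (h : ∀ f ∈ fs, IsLyndon f ∧ F ≤ f) {t v : List β}
    (he : F = t ++ v) (hv : v = [] ∨ t = []) :
    keyRank (factorRows fs) t (omega F) = 0 := by
  have hkey : ∀ v', (∃ t', F = t' ++ v') → omega F ≤ iapp v' (omega F) := by
    rintro v' ⟨t', he'⟩
    by_cases ht : t' = []
    · subst ht
      rw [List.nil_append] at he'
      rw [← he', iapp_omega hF.1]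
    by_cases hv' : v' = []
    · subst hv'; exact le_rfl
    exact (hF.omega_lt_iapp he' ht hv').le
  rw [keyRank, Multiset.countP_eq_zero]
  intro x hx
  obtain ⟨ρ, hρ, rfl⟩ := Multiset.mem_map.1 hx
  rw [not_lt]
  rcases Multiset.mem_add.1 hρ with hρ | hρ
  · have := omega_le_idrop_of_mem_factorRows hF h hρ 0
    rwa [idrop_zero] at this
  · obtain ⟨t', c, v', ht, rfl⟩ := mem_innerRows hρ
    rcases hv with rfl | rfl
    · refine hkey v' ⟨t' ++ [c], ?_⟩
      rw [he, ht]; simp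
    · simp at ht

theorem consistent_concat (hF : F ≠ []) (h : ∀ f ∈ fs, f ≠ []) {u v : List β} (he : F = u ++ v) :
    Consistent (factorRows fs + innerRows u (iapp v (omega F))) := by
  have h1 : Consistent (factorRows (fs ++ [F])) := consistent_factorRows fun f hf => by
    rcases List.mem_append.1 hf with hf | hf
    · exact h f hf
    · rw [List.mem_singleton.1 hf]; exact hF
  refine h1.mono ?_
  rw [factorRows_append, factorRows_singleton, conjRows]
  conv_rhs => rw [he, innerRows_append, ← he]
  rw [← add_assoc]
  exact Multiset.le_add_right _ _

/-- One step of the extraction of the factor `u c v`, from its end to its start. -/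
theorem extraction_step [DecidableEq β] (hF : IsLyndon F) (h : ∀ f ∈ fs, IsLyndon f ∧ F ≤ f)
    {u v : List β} {c : β} (he : F = u ++ c :: v) {R : List β} {r : ℕ}
    (hR : R = bwtOf (factorRows fs + innerRows (u ++ [c]) (iapp v (omega F))))
    (hr : r = keyRank (factorRows fs) (u ++ [c]) (iapp v (omega F))) :
    r ≤ (bwtOf (factorRows fs + innerRows u (iapp (c :: v) (omega F)))).length ∧
    R = (bwtOf (factorRows fs + innerRows u (iapp (c :: v) (omega F)))).insertIdx r c ∧
    (u = [] → countLt R c + (R.take r).count c = 0) ∧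
    (u ≠ [] → countLt R c + (R.take r).count c =
      keyRank (factorRows fs) u (iapp (c :: v) (omega F)) + 1) := by
  have hc := consistent_concat (fs := fs) hF.1 (fun f hf => (h f hf).1.1)
    (u := u ++ [c]) (v := v) (by rw [he]; simp)
  have h1 := bwtOf_innerRows_concat hc
  have h2 := countLt_add_count_innerRows_concat
    (extensions_factorRows fun f hf => (h f hf).1.1) hc
  rw [← iapp_append, List.append_assoc, List.singleton_append, ← he, iapp_omega hF.1,
    ← iapp_cons] at h2
  subst hR hr
  refine ⟨h1.2, h1.1, fun hu => ?_, fun hu => ?_⟩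
  · subst hu
    rw [List.nil_append] at he
    rw [List.nil_append] at h2 ⊢
    rw [h2, ← he, iapp_omega hF.1, keyRank_self hF h (t := []) (v := F) rfl (Or.inr rfl),
      if_neg (lt_irrefl _)]
  -- The additional extension is `omega F`, and it is smaller than the key of the proper suffix `c
  -- v`.
  · rw [h2, if_pos (hF.omega_lt_iapp he hu (by simp))]

end ranks

/-! ### The memory during the extraction of factors -/

/-- The cells behind the remaining transform. -/
noncomputable def tail (conv : Bool) (s : List ℕ) : List ℕ := if conv then delimText 0 s else s

/-- The machine is at instruction `pc`, and the memory holds the transform `R` and the extracted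
word `s`; the current position is `r`. -/
def Snapshot (conv : Bool) (total : ℕ) (R s : List ℕ) (pc r : ℕ) (d : Config 13) : Prop :=
  (R ++ tail conv s).length = total ∧
  ∃ ρ : Regs, ρ.total = total ∧ ρ.one = 1 ∧ ρ.zero = 0 ∧ ρ.len = R.length ∧
    (pc = 5 → ρ.pos = r) ∧ (conv = true → ρ.dpos = R.length + delimPos 0 s) ∧
    d = ⟨pc, ρ.get, R ++ tail conv s⟩

section extraction

variable {w σ B total : ℕ} {conv : Bool}

theorem length_delimText_zero (s : List ℕ) : (delimText 0 s).length = s.length + 1 := by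
  rw [delimText, length_bwtOf, zero_add, card_innerRows, List.length_cons]

theorem delimPos_zero_lt (s : List ℕ) : delimPos 0 s < (delimText 0 s).length := by
  have := delimPos_le (0 : Multiset (Row ℕ)) s
  rw [length_bwtOf, zero_add, card_innerRows] at this
  rw [length_delimText_zero]
  omega

theorem zero_notMem_of_plain {s : List ℕ} (hs : Plain σ s) : (⊥ : ℕ) ∉ s := fun h => (hs _ h).1 rfl

theorem plain_delimText_set {s : List ℕ} {c : ℕ} (hs : Plain σ s) (hc : c ≠ 0 ∧ c ≤ σ) :
    Plain σ ((delimText 0 s).set (delimPos 0 s) c) := by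
  rw [← bwtOf_innerRows_bots_cons (by simp) (zero_notMem_of_plain hs)]
  intro a ha
  have := mem_bwtOf_factorRows_add (fs := []) ha
  rcases this with ⟨f, hf, -⟩ | h
  · simp at hf
  · rcases List.mem_cons.1 h with rfl | h
    · exact hc
    · exact hs a h

theorem insertIdx_append_right {ι : Type*} (l m : List ι) {k j : ℕ} (h : k = l.length + j) (a : ι) :
    (l ++ m).insertIdx k a = l ++ m.insertIdx j a := by
  rw [h, insertIdx_append_add]

/-- The cell freed by deleting entry `r` of the transform is reused by the stored word. With
conversion that word changes as in `delimText_cons`, for the empty multiset of other rows. -/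
theorem step_reaches (hw : B < 2 ^ w) (hB : σ ≤ B) (ht : total ≤ B) {R R' s : List ℕ} {r c : ℕ}
    (hr : r ≤ R'.length) (hR : R = R'.insertIdx r c) (hRP : Plain σ R) (hs : Plain σ s)
    {d : Config 13} (hd : Snapshot conv total R s 5 r d) (hG : Good σ B d) :
    Reaches w (inversion conv) σ B d (14 * total + 30)
      (Snapshot conv total R' (c :: s) (if countLt R c + (R.take r).count c = 0 then 3 else 5)
        (countLt R c + (R.take r).count c - 1)) := by
  obtain ⟨hlen, ⟨a0, a1, a2, a3, a4, a5, a6, a7, a8, a9, a10, a11, a12, a13⟩, h0, h1, h2, h3, h4,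
    h5, rfl⟩ := hd
  simp only [forall_const] at h0 h1 h2 h3 h4 h5
  subst h1 h2 h3
  obtain rfl := h0.symm
  obtain rfl := h4.symm
  have hRl : R.length = R'.length + 1 := by rw [hR, List.length_insertIdx_of_le_length hr]
  have hcR : R[r]? = some c := by rw [hR, List.getElem?_insertIdx_self, if_pos hr]
  have hRr : R.eraseIdx r = R' := by rw [hR, List.eraseIdx_insertIdx_self]
  have hcs := hRP c (List.mem_of_getElem? hcR)
  have hrR : r < R.length := by omega
  have hcM : (R ++ tail conv s)[r]? = some c := by rw [List.getElem?_append_left hrR, hcR]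
  have hM1 : segmentRank (R ++ tail conv s) 0 R.length r c =
      countLt R c + (R.take r).count c := by
    rw [segmentRank, List.take_left, List.drop_zero, Nat.sub_zero]
  -- the cells after the step
  have key : Plain σ ((R ++ tail conv s).set (if conv then a5 else r) c) ∧
      (conv = true → R.length ≤ a5 ∧ a5 < (R ++ tail conv s).length) ∧
      (conv = true → R.length - 1 + segmentRank (R ++ tail conv s) R.length
        (if conv then (R ++ tail conv s).length else R.length) a5 c =
        R'.length + delimPos 0 (c :: s)) ∧
      (((R ++ tail conv s).set (if conv then a5 else r) c).eraseIdx r).insertIdx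
        (R.length - 1 + segmentRank (R ++ tail conv s) R.length
          (if conv then (R ++ tail conv s).length else R.length) a5 c)
        (if conv then 0 else c) = R' ++ tail conv (c :: s) := by
    cases conv with
    | false =>
      have hset : (R ++ s).set r c = R ++ s := by
        obtain ⟨h1, h2⟩ := List.getElem?_eq_some_iff.1 hcM
        exact (congrArg _ h2.symm).trans (List.set_getElem_self _)
      simp only [tail, Bool.false_eq_true, if_false, false_imp_iff, true_and]
      rw [hset]
      refine ⟨fun v hv => ?_, ?_⟩
      · rcases List.mem_append.1 hv with hv | hv
        · exact hRP v hv
        · exact hs v hv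
      · rw [List.eraseIdx_append_of_lt_length hrR, hRr, segmentRank, List.take_left,
          List.drop_length]
        rw [insertIdx_append_right (j := 0) _ _ (by simp [countLt]; omega)]
        simp
    | true =>
      have h5 := h5 rfl
      have hdp := delimPos_zero_lt s
      simp only [tail, if_true, true_imp_iff] at hlen ⊢
      have hset : (R ++ delimText 0 s).set a5 c = R ++ (delimText 0 s).set (delimPos 0 s) c := by
        rw [List.set_append_right _ _ (by omega), h5, Nat.add_sub_cancel_left]
      -- The scan runs while `$` is still in its cell, so `$` is counted among the smaller
      -- characters, as `delimPos_cons` demands.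
      have hseg : segmentRank (R ++ delimText 0 s) R.length (R ++ delimText 0 s).length a5 c =
          delimPos 0 (c :: s) := by
        rw [segmentRank, List.take_length, List.drop_left, h5, Nat.add_sub_cancel_left,
          delimPos_cons rfl (by simp) (zero_notMem_of_plain hs) hcs.1]
      rw [hset, hseg]
      refine ⟨fun v hv => ?_, ⟨by omega, by rw [List.length_append]; omega⟩, by omega, ?_⟩
      · rcases List.mem_append.1 hv with hv | hv
        · exact hRP v hv
        · exact plain_delimText_set hs hcs v hv
      · rw [List.eraseIdx_append_of_lt_length hrR, hRr,
          insertIdx_append_right (j := delimPos 0 (c :: s)) _ _ (by omega),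
          delimText_cons (by simp) (zero_notMem_of_plain hs)]
        rfl
  obtain ⟨hP, hq, he, hmem⟩ := key
  have hlen' : (R' ++ tail conv (c :: s)).length = (R ++ tail conv s).length := by
    cases conv <;> simp [tail, length_delimText_zero, hRl] <;> omega
  rw [← hlen] at hG ht ⊢
  refine (body_reaches conv hw hB ht (by rw [List.length_append]; omega) hrR hq hcM hP hG).mono
    le_rfl ?_
  rintro d ⟨ρ, g0, g1, g2, g3, g5, g4, rfl⟩
  rw [hM1] at g4 ⊢
  rw [hmem]
  refine ⟨hlen', ρ, g0, g1, g2, g3.trans (by omega), fun h => g4 fun h' => ?_,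
    fun hc => g5.trans (he hc), rfl⟩
  rw [if_pos h'] at h
  omega

theorem plain_bwtOf {fs : List (List ℕ)} {u : List ℕ} {z : Inf ℕ} (hfs : ∀ f ∈ fs, Plain σ f)
    (hu : Plain σ u) : Plain σ (bwtOf (factorRows fs + innerRows u z)) := by
  intro a ha
  rcases mem_bwtOf_factorRows_add ha with ⟨f, hf, h⟩ | h
  · exact hfs f hf a h
  · exact hu a h

theorem Plain.append {s t : List ℕ} (hs : Plain σ s) (ht : Plain σ t) : Plain σ (s ++ t) := by
  intro a ha
  rcases List.mem_append.1 ha with h | h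
  · exact hs a h
  · exact ht a h

/-- Induction removes the last character of the unextracted prefix `u`. The LF count selects the
branch: zero sends control to instruction 3, any other value is one more than the next position. -/
theorem factor_reaches (hw : B < 2 ^ w) (hB : σ ≤ B) (ht : total ≤ B) {fs : List (List ℕ)}
    {F s : List ℕ} (hF : IsLyndon F) (h : ∀ f ∈ fs, IsLyndon f ∧ F ≤ f)
    (hfs : ∀ f ∈ fs, Plain σ f) (hFP : Plain σ F) (hs : Plain σ s) (u : List ℕ) :
    ∀ v, F = u ++ v → u ≠ [] → ∀ d,
    Snapshot conv total (bwtOf (factorRows fs + innerRows u (iapp v (omega F)))) (v ++ s) 5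
      (keyRank (factorRows fs) u (iapp v (omega F))) d → Good σ B d →
    Reaches w (inversion conv) σ B d (u.length * (14 * total + 30))
      (Snapshot conv total (bwtOf (factorRows fs)) (F ++ s) 3 0) := by
  induction u using List.reverseRecOn with
  | nil => intro v _ h0; exact absurd rfl h0
  | append_singleton u c ih =>
    intro v he _ d hd hG
    have he' : F = u ++ c :: v := by rw [he]; simp
    obtain ⟨h1, h2, h3, h4⟩ := extraction_step hF h he' rfl rfl
    have hP : Plain σ (u ++ [c]) := fun a ha => hFP a (by rw [he]; exact List.mem_append_left _ ha)
    have hP' : Plain σ v := fun a ha => hFP a (by rw [he]; exact List.mem_append_right _ ha)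
    have := step_reaches hw hB ht h1 h2 (plain_bwtOf hfs hP) (hP'.append hs) hd hG
    rw [List.length_append, List.length_singleton, Nat.add_mul, Nat.one_mul, Nat.add_comm]
    by_cases hu : u = []
    · rw [h3 hu, if_pos rfl] at this
      subst hu
      refine this.mono (by omega) fun d hd => ?_
      rw [innerRows_nil, add_zero] at hd
      rw [he']
      exact hd
    · rw [h4 hu, if_neg (by omega)] at this
      exact this.bind fun d hG hd => ih (c :: v) he' hu d hd hG

theorem Snapshot.reg_three {R s : List ℕ} {pc r : ℕ} {d : Config 13}
    (h : Snapshot conv total R s pc r d) : d.reg 3 = R.length := by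
  obtain ⟨-, ρ, -, -, -, h3, -, -, rfl⟩ := h
  exact h3

theorem Snapshot.mem_eq {R s : List ℕ} {pc r : ℕ} {d : Config 13}
    (h : Snapshot conv total R s pc r d) : d.mem = R ++ tail conv s := by
  obtain ⟨-, ρ, -, -, -, -, -, -, rfl⟩ := h
  rfl

theorem round_reaches (hw : B < 2 ^ w) (hB : σ ≤ B) (ht : total ≤ B) {fs : List (List ℕ)}
    {F s : List ℕ} (hF : IsLyndon F) (h : ∀ f ∈ fs, IsLyndon f ∧ F ≤ f)
    (hfs : ∀ f ∈ fs, Plain σ f) (hFP : Plain σ F) (hs : Plain σ s) {d : Config 13}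
    (hd : Snapshot conv total (bwtOf (factorRows (fs ++ [F]))) s 3 0 d) (hG : Good σ B d) :
    Reaches w (inversion conv) σ B d (F.length * (14 * total + 30) + 2)
      (Snapshot conv total (bwtOf (factorRows fs)) (F ++ s) 3 0) := by
  have hlen := hd.reg_three
  obtain ⟨hl, ⟨a0, a1, a2, a3, a4, a5, a6, a7, a8, a9, a10, a11, a12, a13⟩, h0, h1, h2, h3, -,
    h5, rfl⟩ := hd
  have hpos : 0 < F.length := List.length_pos_iff.2 hF.1
  have hlen : a3 ≠ 0 := by
    rw [length_bwtOf, card_factorRows] at h3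
    dsimp only at h3
    simp at h3
    omega
  dsimp only at h0 h1 h2 h3 h5
  refine Reaches.jumpEq (t := F.length * (14 * total + 30) + 1) rfl hG
    (fun h' => absurd (show a3 = a2 from h') (by omega)) fun _ hG => ?_
  refine Reaches.move (v := 0) rfl hG Regs.update_4 h2 fun hG => ?_
  refine factor_reaches hw hB ht hF h hfs hFP hs F [] (by simp) hF.1 _ ?_ hG
  rw [factorRows_append, factorRows_singleton, conjRows] at hl h3 h5 ⊢
  refine ⟨hl, _, h0, h1, h2, h3, fun _ => ?_, h5, rfl⟩
  rw [iapp_nil, keyRank_self hF h (t := F) (v := []) (by simp) (Or.inl rfl)]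

theorem rounds_reach (hw : B < 2 ^ w) (hB : σ ≤ B) (ht : total ≤ B) (fs : List (List ℕ)) :
    ∀ s : List ℕ, (∀ f ∈ fs, IsLyndon f) → fs.Pairwise (fun u v => v ≤ u) →
    (∀ f ∈ fs, Plain σ f) → Plain σ s → ∀ d,
    Snapshot conv total (bwtOf (factorRows fs)) s 3 0 d → Good σ B d →
    ∃ n ≤ fs.flatten.length * (14 * total + 32), ∃ d', Exec w (inversion conv) σ B d n d' ∧
      Snapshot conv total [] (fs.flatten ++ s) 3 0 d' ∧
      ∃ τ : ℕ → ℕ, (∀ j < fs.length, τ j < τ (j + 1)) ∧ τ fs.length ≤ n ∧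
        ∀ j ≤ fs.length, ∃ c, Exec w (inversion conv) σ B d (τ j) c ∧
          c.mem = bwtOf (factorRows (fs.take (fs.length - j))) ++
            tail conv ((fs.drop (fs.length - j)).flatten ++ s) := by
  induction fs using List.reverseRecOn with
  | nil =>
    intro s _ _ _ _ d hd hG
    refine ⟨0, Nat.zero_le _, d, .refl d hG, by simpa [bwtOf] using hd, fun _ => 0, by simp, le_rfl, fun j _ => ?_⟩
    exact ⟨d, .refl d hG, by simpa using hd.mem_eq⟩
  | append_singleton fs F ih =>
    intro s h1 h2 h3 hs d hd hG
    have hF := h1 F (by simp)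
    have h : ∀ f ∈ fs, IsLyndon f ∧ F ≤ f := fun f hf =>
      ⟨h1 f (by simp [hf]), (List.pairwise_append.1 h2).2.2 f hf F (by simp)⟩
    have hfs : ∀ f ∈ fs, Plain σ f := fun f hf => h3 f (by simp [hf])
    have hFP := h3 F (by simp)
    have hpos : 0 < F.length := List.length_pos_iff.2 hF.1
    obtain ⟨n, hn, d1, he1, hd1⟩ := round_reaches hw hB ht hF h hfs hFP hs hd hG
    -- A round shortens the transform, so the length register changes and at least one step is made.
    -- This keeps the times `τ` strictly increasing.
    have hn0 : 0 < n := by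
      rcases Nat.eq_zero_or_pos n with rfl | h0
      · have : d1 = d := by cases he1; rfl
        have := hd.reg_three.symm.trans ((congrArg (fun d => d.reg 3) this).symm.trans hd1.reg_three)
        rw [length_bwtOf, card_factorRows, length_bwtOf, card_factorRows] at this
        simp only [List.flatten_append, List.length_append, List.flatten_cons, List.flatten_nil,
          List.length_nil] at this
        omega
      · exact h0
    obtain ⟨m, hm, d2, he2, hd2, τ, hτ1, hτ2, hτ3⟩ := ih (F ++ s) (fun f hf => (h f hf).1)
      (List.pairwise_append.1 h2).1 hfs (hFP.append hs) d1 hd1 he1.good_right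
    refine ⟨n + m, ?_, d2, he1.trans he2, ?_, fun j => j.casesOn 0 fun j => n + τ j, ?_, ?_, ?_⟩
    · have e : (fs ++ [F]).flatten.length = fs.flatten.length + F.length := by simp
      rw [e, Nat.add_mul]
      -- The 2 steps at the start of a round are charged to the characters of the non-empty factor,
      -- which turns 30 into 32.
      nlinarith
    · simpa using hd2
    · intro j hj
      cases j with
      | zero => exact Nat.add_pos_left hn0 _
      | succ j => exact Nat.add_lt_add_left (hτ1 j (by simpa using hj)) n
    · rw [List.length_append, List.length_singleton]
      exact Nat.add_le_add_left hτ2 n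
    · intro j hj
      cases j with
      | zero =>
        refine ⟨d, .refl d hG, ?_⟩
        rw [Nat.sub_zero, List.take_length, List.drop_length]
        simpa using hd.mem_eq
      | succ j =>
        have hj : j ≤ fs.length := by simpa using hj
        obtain ⟨c, hc, hmem⟩ := hτ3 j hj
        refine ⟨c, he1.trans hc, ?_⟩
        rw [hmem, List.length_append, List.length_singleton, Nat.add_sub_add_right,
          List.take_append_of_le_length (by omega), List.drop_append_of_le_length (by omega),
          List.flatten_append, List.append_assoc]
        simp

theorem tail_nil_length : (tail conv []).length = if conv then 1 else 0 := by
  cases conv <;> simp [tail, length_delimText_zero]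

/-- The additional 4 steps are the three initial instructions and the final test for an empty
transform. -/
theorem inversion_exec (hw : B < 2 ^ w) (hB : σ ≤ B) (hB1 : 1 ≤ B) {fs : List (List ℕ)}
    (h1 : ∀ f ∈ fs, IsLyndon f) (h2 : fs.Pairwise (fun u v => v ≤ u)) (h3 : ∀ f ∈ fs, Plain σ f)
    (htotal : (bwtOf (factorRows fs) ++ tail conv []).length = total) (ht : total ≤ B)
    (hG : Good σ B ⟨0, Regs.get ⟨total, 0, 0, 0, 0, 0, 0, 0, 0, 0, 0, 0, 0, 0⟩,
      bwtOf (factorRows fs) ++ tail conv []⟩) :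
    ∃ n ≤ fs.flatten.length * (14 * total + 32) + 4, ∃ d',
      Exec w (inversion conv) σ B
        ⟨0, Regs.get ⟨total, 0, 0, 0, 0, 0, 0, 0, 0, 0, 0, 0, 0, 0⟩,
          bwtOf (factorRows fs) ++ tail conv []⟩ n d' ∧
      d'.pc = (inversion conv).length ∧ d'.mem = tail conv fs.flatten ∧
      ∃ τ : ℕ → ℕ, (∀ j < fs.length, τ j < τ (j + 1)) ∧ τ fs.length ≤ n ∧
        ∀ j ≤ fs.length, ∃ c, Exec w (inversion conv) σ B
          ⟨0, Regs.get ⟨total, 0, 0, 0, 0, 0, 0, 0, 0, 0, 0, 0, 0, 0⟩,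
            bwtOf (factorRows fs) ++ tail conv []⟩ (τ j) c ∧
          c.mem = bwtOf (factorRows (fs.take (fs.length - j))) ++
            tail conv (fs.drop (fs.length - j)).flatten := by
  have hinit : Reaches w (inversion conv) σ B
      ⟨0, Regs.get ⟨total, 0, 0, 0, 0, 0, 0, 0, 0, 0, 0, 0, 0, 0⟩,
        bwtOf (factorRows fs) ++ tail conv []⟩ 3
      (Snapshot conv total (bwtOf (factorRows fs)) [] 3 0) := by
    have hl : total = (bwtOf (factorRows fs)).length + if conv then 1 else 0 := by
      rw [← htotal, List.length_append, tail_nil_length]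
    refine Reaches.const (v := 1) rfl hG Regs.update_1 hB1 hw fun hG => ?_
    refine Reaches.sub (v := (bwtOf (factorRows fs)).length) (a := 0) (b := if conv then 1 else 2)
      rfl hG Regs.update_3 (by cases conv <;> exact hl) hw fun hG => ?_
    refine Reaches.move (v := (bwtOf (factorRows fs)).length) rfl hG Regs.update_5 rfl fun hG => ?_
    refine Reaches.done hG ⟨htotal, _, rfl, rfl, rfl, rfl, fun h => by simp at h, fun _ => ?_, rfl⟩
    rw [delimPos_nil]
    rfl
  obtain ⟨n, hn, d, he, hd⟩ := hinit
  obtain ⟨m, hm, d1, he1, hd1, τ, hτ1, hτ2, hτ3⟩ := rounds_reach hw hB ht fs [] h1 h2 h3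
    (fun _ h => by simp at h) d hd he.good_right
  have hend : Reaches w (inversion conv) σ B d1 1
      (fun d' => d'.pc = (inversion conv).length ∧ d'.mem = tail conv fs.flatten) := by
    have hG := he1.good_right
    obtain ⟨-, ρ, -, -, hz, hl, -, -, rfl⟩ := hd1
    refine Reaches.jumpEq (t := 0) rfl hG (fun _ hG => Reaches.done hG ⟨?_, by simp⟩)
      fun h => absurd (show ρ.len = ρ.zero by rw [hl, hz]; rfl) h
    cases conv <;> rfl
  obtain ⟨l, hl, d2, he2, hd2⟩ := hend
  refine ⟨n + m + l, by omega, d2, (he.trans he1).trans he2, hd2.1, hd2.2, fun j => n + τ j,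
    fun j hj => Nat.add_lt_add_left (hτ1 j hj) n, by dsimp only; omega, fun j hj => ?_⟩
  obtain ⟨c, hc, hmem⟩ := hτ3 j hj
  exact ⟨c, he.trans hc, by simpa using hmem⟩

end extraction

/-! ### From memory cells back to words, with the bounds on time and space -/

section transforms

variable {σ : ℕ}

theorem code_strictMono : StrictMono (code : WithBot (Fin σ) → ℕ) := by
  intro a b h
  cases b with
  | bot => exact absurd h not_lt_bot
  | coe b =>
    cases a with
    | bot => exact Nat.succ_pos _
    | coe a => exact Nat.succ_lt_succ (Fin.lt_def.1 (WithBot.coe_lt_coe.1 h))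

/-- The number stored for a character. -/
def charCode (c : Fin σ) : ℕ := c + 1

theorem charCode_strictMono : StrictMono (charCode : Fin σ → ℕ) :=
  fun _ _ h => Nat.succ_lt_succ h

theorem map_code_lift (u : List (Fin σ)) : (lift u).map code = u.map charCode := by
  rw [lift_eq, List.map_map]
  rfl

theorem plain_map_charCode (u : List (Fin σ)) : Plain σ (u.map charCode) := by
  intro v hv
  obtain ⟨c, -, rfl⟩ := List.mem_map.1 hv
  exact ⟨Nat.succ_ne_zero _, c.isLt⟩

/-- The word `$S` is its own only Lyndon factor, and its cyclic rows may be cut off behind `S`. -/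
theorem map_code_bwt (S : List (Fin σ)) : (bwt S).map code = delimText 0 (S.map charCode) := by
  have hnil : lyndonFactors ([] : List (Fin σ)) = [] :=
    lyndonFactors_eq ⟨rfl, by simp, by simp⟩
  have h := lyndonFactors_delim (coe_strictMono σ) (fun _ => WithBot.coe_ne_bot) []
    (bot_notMem_lift S)
  rw [hnil] at h
  have hb : (⊥ : ℕ) ∉ S.map charCode := zero_notMem_of_plain (plain_map_charCode S)
  have hc : code (⊥ : WithBot (Fin σ)) = (⊥ : ℕ) := rfl
  rw [bwt, map_bbwt code_strictMono, show lyndonFactors (⊥ :: lift S) = [⊥ :: lift S] from h,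
    List.map_singleton, List.map_cons, map_code_lift, factorRows_singleton, delimText, hc]
  have := bwtOf_add_conjRows (fs := []) (isLyndon_bot_cons hb) (by simp) hb
  rwa [factorRows_nil, zero_add] at this

theorem map_code_bbwt_flatten (T : List (Fin σ)) (x : ℕ) :
    (lift (bbwt ((lyndonFactors T).take x).flatten)).map code =
      bwtOf (factorRows (((lyndonFactors T).map (List.map charCode)).take x)) := by
  rw [map_code_lift, map_bbwt_flatten charCode_strictMono, textRows, List.map_take]

theorem size_add_le {n σ k : ℕ} (hn : 0 < n) (hσ : σ ≤ k * n ^ k) :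
    (n + σ + 1).size ≤ n.size * (2 * k + 2) := by
  have hs : 0 < n.size := Nat.size_pos.2 hn
  have h1 : n < 2 ^ n.size := Nat.lt_size_self n
  have h2 : k * n ^ k < 2 ^ k * (2 ^ n.size) ^ k :=
    Nat.mul_lt_mul_of_lt_of_le Nat.lt_two_pow_self (Nat.pow_le_pow_left h1.le k)
      (by positivity)
  rw [← pow_mul, ← pow_add] at h2
  rw [Nat.size_le]
  have h3 : 2 ^ n.size ≤ 2 ^ (n.size * (2 * k + 1)) :=
    Nat.pow_le_pow_right (by norm_num) (Nat.le_mul_of_pos_right _ (by omega))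
  have h4 : 2 ^ (k + n.size * k) ≤ 2 ^ (n.size * (2 * k + 1)) :=
    Nat.pow_le_pow_right (by norm_num) (by nlinarith)
  have h5 : 2 ^ (n.size * (2 * k + 1) + 1) ≤ 2 ^ (n.size * (2 * k + 2)) :=
    Nat.pow_le_pow_right (by norm_num) (by nlinarith)
  rw [pow_succ] at h5
  omega

theorem Good.inPlace {K B bits : ℕ} {c : Config K} (h : Good σ B c)
    (hb : (K + 1) * B.size ≤ bits) : c.InPlace σ bits := by
  refine ⟨h.1, h.2.1, le_trans ?_ hb⟩
  calc ∑ r, (c.reg r).size ≤ ∑ _r : Fin (K + 1), B.size :=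
        Finset.sum_le_sum fun r _ => Nat.size_le_size (h.2.2 r)
    _ = (K + 1) * B.size := by simp

/-- One constant serves both bounds. With `n = T.length`, the time is at most `n (14 (n + 1) + 32) +
4 ≤ 64 n ^ 2`, and the 14 registers, all bounded by `n + σ + 1`, use at most `14 (2 k + 2)` times
`n.size` bits. -/
theorem inversion_transformsInPlace (conv : Bool) {k w : ℕ} {T : List (Fin σ)} (hT : T ≠ [])
    (hσ : σ ≤ k * T.length ^ k) (hw : T.length + σ + 2 ≤ 2 ^ w) {input output : DWord σ}
    {stage : ℕ → DWord σ}
    (hin : input.map code =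
      bwtOf (factorRows ((lyndonFactors T).map (List.map charCode))) ++ tail conv [])
    (hout : output.map code = tail conv (T.map charCode))
    (hstage : ∀ j, (stage j).map code =
      bwtOf (factorRows (((lyndonFactors T).map (List.map charCode)).take
        ((lyndonFactors T).length - j))) ++
      tail conv (((lyndonFactors T).drop ((lyndonFactors T).length - j)).flatten.map charCode)) :
    TransformsInPlace (inversion conv) w input output ((28 * k + 64) * T.length ^ 2)
      ((28 * k + 64) * T.length.size) (lyndonFactors T).length stage := by
  obtain ⟨hfl, hly, hpw⟩ := lyndonFactors_spec T
  have hn : 0 < T.length := List.length_pos_iff.2 hT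
  set fs := (lyndonFactors T).map (List.map charCode) with hfs
  set total := T.length + if conv then 1 else 0 with htotal
  have hflat : fs.flatten = T.map charCode := by rw [hfs, ← List.map_flatten, hfl]
  have hlen : fs.length = (lyndonFactors T).length := List.length_map _
  have hl : (bwtOf (factorRows fs) ++ tail conv []).length = total := by
    rw [List.length_append, tail_nil_length, length_bwtOf, card_factorRows, hflat,
      List.length_map]
  have hle : total ≤ T.length + 1 := by rw [htotal]; split_ifs <;> omega
  have hP : ∀ f ∈ fs, Plain σ f := by
    intro f hf
    obtain ⟨g, -, rfl⟩ := List.mem_map.1 hf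
    exact plain_map_charCode g
  have hreg : (initConfig 13 input) =
      ⟨0, Regs.get ⟨total, 0, 0, 0, 0, 0, 0, 0, 0, 0, 0, 0, 0, 0⟩,
        bwtOf (factorRows fs) ++ tail conv []⟩ := by
    have : input.length = total := by rw [← hl, ← hin, List.length_map]
    rw [initConfig, hin, this]
    congr 1
    funext i
    fin_cases i <;> rfl
  have hR : Plain σ (bwtOf (factorRows fs)) := by
    have := plain_bwtOf (u := []) (z := bots) hP fun _ h => by simp at h
    rwa [innerRows_nil, add_zero] at this
  have htail : tail conv [] = if conv then [0] else [] := by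
    cases conv
    · rfl
    · simp [tail, delimText_nil, bwtOf]
  have hG : Good σ (T.length + σ + 1) ⟨0, Regs.get ⟨total, 0, 0, 0, 0, 0, 0, 0, 0, 0, 0, 0, 0, 0⟩,
      bwtOf (factorRows fs) ++ tail conv []⟩ := by
    refine ⟨fun v hv => ?_, ?_, fun i => ?_⟩
    · rcases List.mem_append.1 hv with hv | hv
      · exact (hR v hv).2
      · rw [htail] at hv
        cases conv <;> simp at hv
        omega
    · rw [List.count_append, hR.count_zero, htail]
      cases conv <;> simp
    · fin_cases i <;> first | exact Nat.zero_le _ | exact hle.trans (by omega)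
  obtain ⟨n, hn', d, he, hpc, hmem, τ, hτ1, hτ2, hτ3⟩ := inversion_exec (w := w) (conv := conv)
    (total := total) (by omega) (by omega) (by omega) (fs := fs)
    (fun f hf => by
      obtain ⟨g, hg, rfl⟩ := List.mem_map.1 hf
      exact (hly g hg).map charCode_strictMono)
    (List.pairwise_map.2 (hpw.imp fun h => map_le_map charCode_strictMono h)) hP hl
    (by omega) hG
  rw [← hreg] at he hτ3
  rw [hlen] at hτ1 hτ2 hτ3
  refine ⟨n, hn'.trans ?_, fun i hi => ?_, ⟨d, he.run_eq, hpc, ?_⟩, τ, hτ1, hτ2, fun j hj => ?_⟩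
  · rw [hflat, List.length_map]
    have : T.length * (14 * total + 32) ≤ T.length * (14 * (T.length + 1) + 32) := by gcongr
    nlinarith [Nat.zero_le (k * T.length ^ 2)]
  · obtain ⟨c, hc, hg⟩ := he.good i hi
    refine ⟨c, hc, hg.inPlace ?_⟩
    have := size_add_le hn hσ
    nlinarith
  · rw [hmem, hout, hflat]
  · obtain ⟨c, hc, hm⟩ := hτ3 j hj
    refine ⟨c, hc.run_eq, ?_⟩
    rw [hm, hstage, hfs, List.map_flatten, List.map_drop]

end transforms

end BBWT

theorem mainTheorem2 :
    -- the algorithm extracts the Lyndon factors in the order `T_t, …, T_1`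
    (∀ (σ : ℕ) (T : List (Fin σ)),
      BBWT.Extracts (BBWT.lift (BBWT.bbwt T)) ((BBWT.lyndonFactors T).reverse.map BBWT.lift)) ∧
    -- while it extracts the factor `F`, preceded by the factors with concatenation `P`, it maintains
    -- the BBWT of `P $ F[i+1..]`, where `$` is at the stored position
    (∀ (σ : ℕ) (T : List (Fin σ)) (x : ℕ) (hx : x < (BBWT.lyndonFactors T).length),
      let P : List (Fin σ) := ((BBWT.lyndonFactors T).take x).flatten
      let F : List (Fin σ) := (BBWT.lyndonFactors T)[x]
      let state : ℕ → BBWT.InvState σ :=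
        fun i => BBWT.invStep^[i] (BBWT.invStart (BBWT.lift (BBWT.bbwt (P ++ F))))
      (∀ i ≤ F.length,
        (state i).text = BBWT.bbwt (BBWT.lift P ++ ⊥ :: BBWT.lift (F.drop i)) ∧
        0 < (state i).pos ∧ (state i).text[(state i).pos - 1]? = some ⊥ ∧
        ((state i).pos = 1 ↔ i = F.length) ∧
        (state i).out = BBWT.lift (F.take i)) ∧
      (state F.length).text.eraseIdx 0 = BBWT.lift (BBWT.bbwt P)) ∧
    -- inversion of the BBWT, in place and in quadratic time
    (∃ (K : ℕ) (prog : BBWT.Program K), ∀ k : ℕ, ∃ C : ℕ,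
      ∀ (σ w : ℕ) (T : List (Fin σ)), T ≠ [] → σ ≤ k * T.length ^ k →
        T.length + σ + 2 ≤ 2 ^ w →
        BBWT.TransformsInPlace prog w
          (BBWT.lift (BBWT.bbwt T)) (BBWT.lift T)
          (C * T.length ^ 2) (C * T.length.size) (BBWT.lyndonFactors T).length
          (fun j =>
            let x := (BBWT.lyndonFactors T).length - j
            BBWT.lift (BBWT.bbwt ((BBWT.lyndonFactors T).take x).flatten) ++
              BBWT.lift ((BBWT.lyndonFactors T).drop x).flatten)) ∧
    -- conversion of the BBWT to the BWT, in place and in quadratic time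
    (∃ (K : ℕ) (prog : BBWT.Program K), ∀ k : ℕ, ∃ C : ℕ,
      ∀ (σ w : ℕ) (T : List (Fin σ)), T ≠ [] → σ ≤ k * T.length ^ k →
        T.length + σ + 2 ≤ 2 ^ w →
        BBWT.TransformsInPlace prog w
          (BBWT.lift (BBWT.bbwt T) ++ [⊥]) (BBWT.bwt T)
          (C * T.length ^ 2) (C * T.length.size) (BBWT.lyndonFactors T).length
          (fun j =>
            let x := (BBWT.lyndonFactors T).length - j
            BBWT.lift (BBWT.bbwt ((BBWT.lyndonFactors T).take x).flatten) ++
              BBWT.bwt ((BBWT.lyndonFactors T).drop x).flatten)) := by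
  refine ⟨fun σ T => BBWT.extracts_bbwt T, fun σ T x hx => BBWT.inversion_invariant T x hx,
    ⟨13, BBWT.inversion false, fun k => ⟨28 * k + 64, ?_⟩⟩,
    ⟨13, BBWT.inversion true, fun k => ⟨28 * k + 64, ?_⟩⟩⟩
  · intro σ w T hT hσ hw
    refine BBWT.inversion_transformsInPlace false hT hσ hw ?_ ?_ fun j => ?_
    · have := BBWT.map_code_bbwt_flatten T (BBWT.lyndonFactors T).length
      rw [List.take_length, (BBWT.lyndonFactors_spec T).1, List.take_of_length_le (by simp)] at this
      rw [this]
      exact (List.append_nil _).symm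
    · exact BBWT.map_code_lift T
    · dsimp only
      rw [List.map_append, BBWT.map_code_bbwt_flatten, BBWT.map_code_lift]
      rfl
  · intro σ w T hT hσ hw
    refine BBWT.inversion_transformsInPlace true hT hσ hw ?_ (BBWT.map_code_bwt T) fun j => ?_
    · have := BBWT.map_code_bbwt_flatten T (BBWT.lyndonFactors T).length
      rw [List.take_length, (BBWT.lyndonFactors_spec T).1, List.take_of_length_le (by simp)] at this
      rw [List.map_append, this]
      simp [BBWT.tail, BBWT.delimText_nil, BBWT.bwtOf, BBWT.code]
    · dsimp only
      rw [List.map_append, BBWT.map_code_bbwt_flatten, BBWT.map_code_bwt]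
      rfl
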